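/- Let $\mathcal H$ be a complex separable Hilbert space (inner product antilinear in the first argument) and let $T$ be a positive (i.e. positive semidefinite and self-adjoint), possibly unbounded operator on $\mathcal H$. Write $Q(T)=D(T^{1/2})$ and $\|\psi\|_T^2=\|\psi\|^2+\|T^{1/2}\psi\|^2$ for $\psi\in Q(T)$. For a positive operator $V$ and a positive trace class operator $\gamma$ put $\operatorname{Tr}(V\gamma):=\sup_{\varepsilon>0}\operatorname{Tr}\big(V(1+\varepsilon V)^{-1}\gamma\big)\in[0,\infty]$. Let $X^+$ be the set of positive trace class operators $\gamma$ on $\mathcal H$ with $\operatorname{Tr}(T\gamma)<\infty$, let $X=X^+-X^+$ (a real vector space), with the norm $$\|\gamma\|_X=\inf\{\operatorname{Tr}((1+T)\gamma^+)+\operatorname{Tr}((1+T)\gamma^-)\;:\;\gamma=\gamma^+-\gamma^-,\ \gamma^\pm \text{ positive trace class}\},$$ and let $X^*$ be the space of linear functionals $\omega:X\to\mathbb R$ with $|\omega(\gamma)|\le C\|\gamma\|_X$ for some $C>0$ and all $\gamma\in X$, with the norm $\|\omega\|_{X^*}=\sup_{0\ne\gamma\in X}|\omega(\gamma)|/\|\gamma\|_X$.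 For $\gamma=\gamma^+-\gamma^-$ with $\gamma^\pm\in X^+$, and a positive operator $V$ with $\operatorname{Tr}(V\gamma^\pm)<\infty$, put $\operatorname{Tr}(V\gamma):=\operatorname{Tr}(V\gamma^+)-\operatorname{Tr}(V\gamma^-)$. Let $\mathcal F(T)$ be the real vector space of Hermitian sesquilinear forms $v:Q(T)\times Q(T)\to\mathbb C$ such that $|v(\psi,\psi)|\le C\|\psi\|_T^2$ for some $C>0$ and all $\psi\in Q(T)$, with the norm $\|v\|_{\mathcal F(T)}=\sup_{0\ne\psi\in Q(T)}|v(\psi,\psi)|/\|\psi\|_T^2$. Then $|\psi\rangle\langle\psi|\in X$ for every $\psi\in Q(T)$, and there is a real-linear bijection $\Phi:X^*\to\mathcal F(T)$, $\omega\mapsto v_\omega$, such that: 1. $\|v_\omega\|_{\mathcal F(T)}=\|\omega\|_{X^*}$ for all $\omega\in X^*$. 2. $v_\omega(\psi,\varphi)=\frac14\sum_{k=0}^3 i^k\,\omega\big(|\psi+(-i)^k\varphi\rangle\langle\psi+(-i)^k\varphi|\big)$ for all $\psi,\varphi\in Q(T)$; in particular $v_\omega(\psi,\psi)=\omega(|\psi\rangle\langle\psi|)$.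 3. Let $v\in\mathcal F(T)$ and $\omega=\Phi^{-1}(v)$. For all sufficiently small $\lambda>0$ there are $a\in[0,1)$ and $b\ge0$ with $$|\lambda v(\psi,\psi)|\le a\|T^{1/2}\psi\|^2+b\|\psi\|^2\quad\text{for all }\psi\in Q(T).$$ For every $\lambda>0$ and all such $a,b$, there is a unique lower semibounded self-adjoint operator $C=T\dot+\lambda v$ whose associated sesquilinear form has domain $Q(T)$ and equals $\langle T^{1/2}\psi,T^{1/2}\varphi\rangle+\lambda v(\psi,\varphi)$; it satisfies $C\ge -b$; and for every real lower bound $\mu$ of $C$ and every $\gamma\in X$ (with any decomposition $\gamma=\gamma^+-\gamma^-$, $\gamma^\pm\in X^+$) one has $\operatorname{Tr}((C-\mu)\gamma^\pm)<\infty$ and $$\omega(\gamma)=\lambda^{-1}\big[\operatorname{Tr}((C-\mu)\gamma)-\operatorname{Tr}(T\gamma)+\mu\operatorname{Tr}(\gamma)\big].$$ -/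

import Mathlib

open ContinuousLinearMap in
/-- Criterion for self-adjointness of a densely defined operator: symmetric, and the domain of the
adjoint is not larger. -/
theorem LinearPMap.isSelfAdjoint_of_symmetric_of_maximal
    {H : Type*} [NormedAddCommGroup H] [InnerProductSpace ℂ H] [CompleteSpace H]
    (A : H →ₗ.[ℂ] H) (hd : Dense (A.domain : Set H))
    (hs : ∀ x y : A.domain, inner ℂ (A x) (y : H) = inner ℂ (x : H) (A y))
    (hm : ∀ y w : H, (∀ x : A.domain, inner ℂ w (x : H) = inner ℂ y (A x)) → y ∈ A.domain) :
    IsSelfAdjoint A := by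
  rw [LinearPMap.isSelfAdjoint_def]
  have h1 : A ≤ A.adjoint := LinearPMap.IsFormalAdjoint.le_adjoint hd
    (fun x y => hs x y)
  refine (LinearPMap.eq_of_le_of_domain_eq h1 ?_).symm
  refine le_antisymm h1.1 ?_
  intro y hy
  refine hm y (A.adjoint ⟨y, hy⟩) (fun x => ?_)
  exact LinearPMap.adjoint_isFormalAdjoint hd ⟨y, hy⟩ x

theorem LinearPMap.symmetric_of_isSelfAdjoint
    {H : Type*} [NormedAddCommGroup H] [InnerProductSpace ℂ H] [CompleteSpace H]
    {A : H →ₗ.[ℂ] H} (h : IsSelfAdjoint A) (x y : A.domain) :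
    inner ℂ (A x) (y : H) = inner ℂ (x : H) (A y) := by
  have := LinearPMap.adjoint_isFormalAdjoint h.dense_domain
  rw [LinearPMap.isSelfAdjoint_def.mp h] at this
  exact this x y

theorem LinearPMap.mem_domain_of_isSelfAdjoint
    {H : Type*} [NormedAddCommGroup H] [InnerProductSpace ℂ H] [CompleteSpace H]
    {A : H →ₗ.[ℂ] H} (h : IsSelfAdjoint A) (y w : H)
    (hw : ∀ x : A.domain, inner ℂ w (x : H) = inner ℂ y (A x)) :
    ∃ hy : y ∈ A.domain, A ⟨y, hy⟩ = w := by
  have hy : y ∈ A.adjoint.domain := LinearPMap.mem_adjoint_domain_of_exists y ⟨w, hw⟩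
  have hy' : y ∈ A.domain := by rwa [LinearPMap.isSelfAdjoint_def.mp h] at hy
  refine ⟨hy', ?_⟩
  refine h.dense_domain.eq_of_inner_left ℂ (fun v hv => ?_)
  rw [LinearPMap.symmetric_of_isSelfAdjoint h ⟨y, hy'⟩ ⟨v, hv⟩, hw ⟨v, hv⟩]

theorem LinearPMap.isSelfAdjoint_real_smul_vadd
    {H : Type*} [NormedAddCommGroup H] [InnerProductSpace ℂ H] [CompleteSpace H]
    {A : H →ₗ.[ℂ] H} (h : IsSelfAdjoint A) (c : ℝ) :
    IsSelfAdjoint (((c : ℂ) • (LinearMap.id : H →ₗ[ℂ] H)) +ᵥ A) := by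
  apply LinearPMap.isSelfAdjoint_of_symmetric_of_maximal
  · exact h.dense_domain
  · intro x y
    have := LinearPMap.symmetric_of_isSelfAdjoint h x y
    simp only [LinearPMap.vadd_apply, LinearMap.smul_apply, LinearMap.id_coe, id_eq,
      inner_add_left, inner_add_right, inner_smul_left, inner_smul_right, Complex.conj_ofReal]
    rw [← this]
  · intro y w hw
    refine (LinearPMap.mem_domain_of_isSelfAdjoint h y (w - (c : ℂ) • y) (fun x => ?_)).1
    have := hw x
    simp only [LinearPMap.vadd_apply, LinearMap.smul_apply, LinearMap.id_coe, id_eq,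
      inner_add_right, inner_smul_right] at this
    rw [inner_sub_left, this, inner_smul_left, Complex.conj_ofReal]
    ring_nf

/-- A positive (that is, positive semidefinite and self-adjoint), possibly unbounded operator. -/
structure PosOp (H : Type*) [NormedAddCommGroup H] [InnerProductSpace ℂ H] [CompleteSpace H] where
  toPMap : H →ₗ.[ℂ] H
  isSelfAdjoint : IsSelfAdjoint toPMap
  nonneg : ∀ ψ : toPMap.domain, 0 ≤ (inner ℂ (ψ : H) (toPMap ψ)).re

/-- `μ` is a lower bound of the operator `C`. -/
def IsLowerBound {H : Type*} [NormedAddCommGroup H] [InnerProductSpace ℂ H]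
    (C : H →ₗ.[ℂ] H) (μ : ℝ) : Prop :=
  ∀ ψ : C.domain, μ * ‖(ψ : H)‖ ^ 2 ≤ (inner ℂ (ψ : H) (C ψ)).re

namespace PosOp

section

variable {H : Type*} [NormedAddCommGroup H] [InnerProductSpace ℂ H] [CompleteSpace H]

/-- The positive operator `C - μ`, for a self-adjoint operator `C` with lower bound `μ`. -/
def subLowerBound (C : H →ₗ.[ℂ] H) (hC : IsSelfAdjoint C) (μ : ℝ) (hμ : IsLowerBound C μ) :
    PosOp H where
  toPMap := (((-μ : ℝ) : ℂ) • (LinearMap.id : H →ₗ[ℂ] H)) +ᵥ C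
  isSelfAdjoint := LinearPMap.isSelfAdjoint_real_smul_vadd hC (-μ)
  nonneg := fun ψ => by
    have h := hμ ψ
    have e : (inner ℂ (ψ : H) (ψ : H)).re = ‖(ψ : H)‖ ^ 2 := inner_self_eq_norm_sq (𝕜 := ℂ) _
    rw [LinearPMap.vadd_apply, LinearMap.smul_apply, LinearMap.id_apply,
      inner_add_right, inner_smul_right, Complex.add_re, Complex.re_ofReal_mul, e]
    linarith

/-- The positive operator `1 + T`. -/
def oneAdd (T : PosOp H) : PosOp H where
  toPMap := (((1 : ℝ) : ℂ) • (LinearMap.id : H →ₗ[ℂ] H)) +ᵥ T.toPMap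
  isSelfAdjoint := LinearPMap.isSelfAdjoint_real_smul_vadd T.isSelfAdjoint 1
  nonneg := fun ψ => by
    have h := T.nonneg ψ
    have e : (inner ℂ (ψ : H) (ψ : H)).re = ‖(ψ : H)‖ ^ 2 := inner_self_eq_norm_sq (𝕜 := ℂ) _
    rw [LinearPMap.vadd_apply, LinearMap.smul_apply, LinearMap.id_apply,
      inner_add_right, inner_smul_right, Complex.add_re, Complex.re_ofReal_mul, e, one_mul]
    exact add_nonneg (sq_nonneg _) h

variable (T : PosOp H)

theorem inner_self_im (x : T.toPMap.domain) : (inner ℂ (x : H) (T.toPMap x)).im = 0 := by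
  have h := LinearPMap.symmetric_of_isSelfAdjoint T.isSelfAdjoint x x
  rw [← inner_conj_symm] at h
  exact Complex.conj_eq_iff_im.mp h

theorem norm_sq_add_smul (ε : Set.Ioi (0 : ℝ)) (x : T.toPMap.domain) :
    ‖(x : H)‖ ^ 2 + ‖((ε : ℝ) : ℂ) • T.toPMap x‖ ^ 2 ≤
      ‖(x : H) + ((ε : ℝ) : ℂ) • T.toPMap x‖ ^ 2 := by
  rw [norm_add_sq (𝕜 := ℂ), inner_smul_right]
  have h1 := T.nonneg x
  have h2 : (0 : ℝ) < ε := ε.2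
  have h3 : 0 ≤ RCLike.re (((ε : ℝ) : ℂ) * inner ℂ (x : H) (T.toPMap x)) := by
    simp only [RCLike.re_to_complex, Complex.mul_re, Complex.ofReal_re, Complex.ofReal_im]
    simp only [zero_mul, sub_zero]
    positivity
  linarith

/-- The linear map `1 + εT` on the domain of `T`. -/
def oneAddSMul (ε : Set.Ioi (0 : ℝ)) : T.toPMap.domain →ₗ[ℂ] H :=
  T.toPMap.domain.subtype + ((ε : ℝ) : ℂ) • T.toPMap.toFun

theorem oneAddSMul_apply (ε : Set.Ioi (0 : ℝ)) (x : T.toPMap.domain) :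
    T.oneAddSMul ε x = (x : H) + ((ε : ℝ) : ℂ) • T.toPMap x := rfl

theorem norm_le_oneAddSMul (ε : Set.Ioi (0 : ℝ)) (x : T.toPMap.domain) :
    ‖(x : H)‖ ≤ ‖T.oneAddSMul ε x‖ := by
  have := T.norm_sq_add_smul ε x
  rw [oneAddSMul_apply]
  refine le_of_sq_le_sq (by nlinarith [sq_nonneg ‖((ε : ℝ) : ℂ) • T.toPMap x‖]) (norm_nonneg _)

theorem oneAddSMul_bijective (ε : Set.Ioi (0 : ℝ)) : Function.Bijective (T.oneAddSMul ε) := by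
  have hε : (0 : ℝ) < ε := ε.2
  have hε0 : ((ε : ℝ) : ℂ) ≠ 0 := by exact_mod_cast hε.ne'
  constructor
  · rw [injective_iff_map_eq_zero]
    intro x hx
    have := T.norm_le_oneAddSMul ε x
    rw [hx, norm_zero] at this
    exact Subtype.ext (norm_le_zero_iff.mp this)
  · rw [← LinearMap.range_eq_top]
    have hcl : IsClosed ((LinearMap.range (T.oneAddSMul ε) : Submodule ℂ H) : Set H) := by
      have hg : IsClosed (T.toPMap.graph : Set (H × H)) := T.isSelfAdjoint.isClosed
      let g : T.toPMap.graph → H := fun p => p.1.1 + ((ε : ℝ) : ℂ) • p.1.2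
      have hgc : UniformContinuous g := by
        have : UniformContinuous (fun p : H × H => p.1 + ((ε : ℝ) : ℂ) • p.2) :=
          uniformContinuous_fst.add (uniformContinuous_snd.const_smul _)
        exact this.comp uniformContinuous_subtype_val
      have hga : AntilipschitzWith (1 + ‖(((ε : ℝ) : ℂ))⁻¹‖₊) g := by
        refine AntilipschitzWith.of_le_mul_dist (fun p q => ?_)
        have key : ∀ r : T.toPMap.graph,
            ‖(r : H × H)‖ ≤ (1 + ‖(((ε : ℝ) : ℂ))⁻¹‖) * ‖r.1.1 + ((ε : ℝ) : ℂ) • r.1.2‖ := by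
          intro r
          obtain ⟨x, hx1, hx2⟩ := (LinearPMap.mem_graph_iff _).mp r.2
          have h0 := T.norm_sq_add_smul ε x
          rw [hx1, hx2] at h0
          have ha : ‖r.1.1‖ ≤ ‖r.1.1 + ((ε : ℝ) : ℂ) • r.1.2‖ :=
            le_of_sq_le_sq (by nlinarith [sq_nonneg ‖((ε : ℝ) : ℂ) • r.1.2‖]) (norm_nonneg _)
          have hb : ‖((ε : ℝ) : ℂ) • r.1.2‖ ≤ ‖r.1.1 + ((ε : ℝ) : ℂ) • r.1.2‖ :=
            le_of_sq_le_sq (by nlinarith [sq_nonneg ‖r.1.1‖]) (norm_nonneg _)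
          have hc : ‖r.1.2‖ = ‖(((ε : ℝ) : ℂ))⁻¹‖ * ‖((ε : ℝ) : ℂ) • r.1.2‖ := by
            rw [← norm_smul, smul_smul, inv_mul_cancel₀ hε0, one_smul]
          rw [Prod.norm_def]
          refine max_le ?_ ?_
          · nlinarith [norm_nonneg (((ε : ℝ) : ℂ))⁻¹,
              norm_nonneg (r.1.1 + ((ε : ℝ) : ℂ) • r.1.2)]
          · rw [hc]
            nlinarith [norm_nonneg (((ε : ℝ) : ℂ))⁻¹,
              norm_nonneg (r.1.1 + ((ε : ℝ) : ℂ) • r.1.2)]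
        have h1 := key (p - q)
        rw [dist_eq_norm, dist_eq_norm]
        have h2 : g p - g q = (p - q).1.1 + ((ε : ℝ) : ℂ) • (p - q).1.2 := by
          simp only [g, Submodule.coe_sub, Prod.fst_sub, Prod.snd_sub, smul_sub]
          abel
        rw [h2]
        exact h1
      have hcs : CompleteSpace T.toPMap.graph := hg.completeSpace_coe
      have := hga.isClosed_range hgc
      convert this using 1
      ext y
      constructor
      · rintro ⟨x, rfl⟩
        exact ⟨⟨_, T.toPMap.mem_graph x⟩, rfl⟩
      · rintro ⟨r, rfl⟩
        obtain ⟨x, hx1, hx2⟩ := (LinearPMap.mem_graph_iff _).mp r.2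
        exact ⟨x, by rw [oneAddSMul_apply, hx1, hx2]⟩
    have hcs : CompleteSpace (LinearMap.range (T.oneAddSMul ε) : Submodule ℂ H) :=
      hcl.completeSpace_coe
    rw [← Submodule.orthogonal_eq_bot_iff, Submodule.eq_bot_iff]
    intro y hy
    have hy' : ∀ x : T.toPMap.domain,
        inner ℂ y (x : H) + ((ε : ℝ) : ℂ) * inner ℂ y (T.toPMap x) = 0 := by
      intro x
      have := Submodule.inner_left_of_mem_orthogonal (LinearMap.mem_range_self (T.oneAddSMul ε) x) hy
      rwa [oneAddSMul_apply, inner_add_right, inner_smul_right] at this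
    obtain ⟨hyd, hTy⟩ := LinearPMap.mem_domain_of_isSelfAdjoint T.isSelfAdjoint y
      (-((((ε : ℝ) : ℂ))⁻¹ • y)) (fun x => by
        rw [inner_neg_left, inner_smul_left, map_inv₀, Complex.conj_ofReal]
        have := hy' x
        field_simp
        linear_combination -this)
    have h1 := hy' ⟨y, hyd⟩
    have h2 := T.nonneg ⟨y, hyd⟩
    have h3 := congrArg Complex.re h1
    simp only [Complex.add_re, Complex.mul_re, Complex.ofReal_re, Complex.ofReal_im, zero_mul,
      sub_zero, Complex.zero_re] at h3
    have h4 : (inner ℂ y y : ℂ).re = ‖y‖ ^ 2 := by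
      rw [inner_self_eq_norm_sq_to_K]; norm_cast
    rw [h4] at h3
    have : ‖y‖ ^ 2 ≤ 0 := by
      have : 0 ≤ (ε : ℝ) * (inner ℂ y (T.toPMap ⟨y, hyd⟩)).re := mul_nonneg hε.le h2
      linarith
    exact norm_eq_zero.mp (pow_eq_zero_iff (two_ne_zero) |>.mp (le_antisymm this (sq_nonneg _)))

/-- The bounded operator `(1 + εT)⁻¹`, for `ε > 0`. -/
noncomputable def resolvent (ε : Set.Ioi (0 : ℝ)) : H →L[ℂ] H :=
  (T.toPMap.domain.subtype ∘ₗ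
    (LinearEquiv.ofBijective (T.oneAddSMul ε) (T.oneAddSMul_bijective ε)).symm.toLinearMap
      ).mkContinuous 1 (fun y => by
    have := T.norm_le_oneAddSMul ε
      ((LinearEquiv.ofBijective (T.oneAddSMul ε) (T.oneAddSMul_bijective ε)).symm y)
    rw [one_mul]
    refine this.trans (le_of_eq ?_)
    congr 1
    exact (LinearEquiv.ofBijective (T.oneAddSMul ε) (T.oneAddSMul_bijective ε)).apply_symm_apply y)

theorem resolvent_mem (ε : Set.Ioi (0 : ℝ)) (y : H) : T.resolvent ε y ∈ T.toPMap.domain :=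
  Subtype.property _

theorem resolvent_right (ε : Set.Ioi (0 : ℝ)) (y : H) :
    T.resolvent ε y + ((ε : ℝ) : ℂ) • T.toPMap ⟨T.resolvent ε y, T.resolvent_mem ε y⟩ = y :=
  (LinearEquiv.ofBijective (T.oneAddSMul ε) (T.oneAddSMul_bijective ε)).apply_symm_apply y

theorem resolvent_left (ε : Set.Ioi (0 : ℝ)) (x : T.toPMap.domain) :
    T.resolvent ε ((x : H) + ((ε : ℝ) : ℂ) • T.toPMap x) = x :=
  congrArg Subtype.val
    ((LinearEquiv.ofBijective (T.oneAddSMul ε) (T.oneAddSMul_bijective ε)).symm_apply_apply x)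

theorem toPMap_congr {x y : T.toPMap.domain} (h : (x : H) = y) : T.toPMap x = T.toPMap y := by
  rw [Subtype.ext h]

theorem inner_resolvent (ε : Set.Ioi (0 : ℝ)) (y z : H) :
    inner ℂ (T.resolvent ε y) z = inner ℂ y (T.resolvent ε z) := by
  have hy := T.resolvent_right ε y
  have hz := T.resolvent_right ε z
  have hs := LinearPMap.symmetric_of_isSelfAdjoint T.isSelfAdjoint
    ⟨_, T.resolvent_mem ε y⟩ ⟨_, T.resolvent_mem ε z⟩
  conv_lhs => rw [← hz]
  conv_rhs => rw [← hy]
  rw [inner_add_left, inner_add_right, inner_smul_left, inner_smul_right, Complex.conj_ofReal, hs]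

theorem resolvent_nonneg (ε : Set.Ioi (0 : ℝ)) : 0 ≤ T.resolvent ε := by
  rw [ContinuousLinearMap.nonneg_iff_isPositive]
  refine ⟨fun y z => T.inner_resolvent ε y z, fun y => ?_⟩
  have hy := T.resolvent_right ε y
  have h1 := T.nonneg ⟨_, T.resolvent_mem ε y⟩
  have h2 : (0 : ℝ) < ε := ε.2
  rw [ContinuousLinearMap.reApplyInnerSelf_apply]
  change 0 ≤ (inner ℂ (T.resolvent ε y) y).re
  set x : T.toPMap.domain := ⟨_, T.resolvent_mem ε y⟩ with hx
  have h4 : y = (x : H) + ((ε : ℝ) : ℂ) • T.toPMap x := hy.symm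
  have h5 : T.resolvent ε y = (x : H) := rfl
  have e : (inner ℂ (x : H) (x : H)).re = ‖(x : H)‖ ^ 2 := inner_self_eq_norm_sq (𝕜 := ℂ) _
  rw [h5, h4, inner_add_right, inner_smul_right, Complex.add_re, Complex.re_ofReal_mul, e]
  exact add_nonneg (sq_nonneg _) (mul_nonneg h2.le h1)

theorem resolvent_le_one (ε : Set.Ioi (0 : ℝ)) : T.resolvent ε ≤ 1 := by
  rw [ContinuousLinearMap.le_def]
  refine ⟨fun y z => ?_, fun y => ?_⟩
  · have h := T.inner_resolvent ε y z
    simp only [ContinuousLinearMap.coe_coe, sub_apply,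
      one_apply_eq_self, inner_sub_left, inner_sub_right, h]
  · have hy := T.resolvent_right ε y
    have h1 := T.nonneg ⟨_, T.resolvent_mem ε y⟩
    have h2 : (0 : ℝ) < ε := ε.2
    have hR := (ContinuousLinearMap.nonneg_iff_isPositive _).mp (T.resolvent_nonneg ε)
    rw [ContinuousLinearMap.reApplyInnerSelf_apply]
    set x : T.toPMap.domain := ⟨_, T.resolvent_mem ε y⟩ with hx
    have h3 : ((1 : H →L[ℂ] H) - T.resolvent ε) y = ((ε : ℝ) : ℂ) • T.toPMap x := by
      rw [sub_apply, one_apply_eq_self, sub_eq_iff_eq_add']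
      exact hy.symm
    rw [h3]
    have h4 : y = (x : H) + ((ε : ℝ) : ℂ) • T.toPMap x := hy.symm
    have e : (inner ℂ (((ε : ℝ) : ℂ) • T.toPMap x) (((ε : ℝ) : ℂ) • T.toPMap x)).re =
      ‖((ε : ℝ) : ℂ) • T.toPMap x‖ ^ 2 := inner_self_eq_norm_sq (𝕜 := ℂ) _
    have h5 : (inner ℂ (T.toPMap x) (x : H)).re = (inner ℂ (x : H) (T.toPMap x)).re := by
      rw [← inner_conj_symm, Complex.conj_re]
    change 0 ≤ (inner ℂ (((ε : ℝ) : ℂ) • T.toPMap x) y).re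
    rw [h4, inner_add_right, Complex.add_re, e, inner_smul_left, Complex.conj_ofReal,
      Complex.re_ofReal_mul, h5]
    exact add_nonneg (mul_nonneg h2.le h1) (sq_nonneg _)

/-- The bounded operator `T(1 + εT)⁻¹`, for `ε > 0`; it equals `ε⁻¹(1 - (1 + εT)⁻¹)`, and is
introduced in this form because its boundedness is then evident. -/
noncomputable def yosida (ε : Set.Ioi (0 : ℝ)) : H →L[ℂ] H :=
  (((ε : ℝ) : ℂ))⁻¹ • (1 - T.resolvent ε)

theorem yosida_apply (ε : Set.Ioi (0 : ℝ)) (y : H) :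
    T.yosida ε y = T.toPMap ⟨T.resolvent ε y, T.resolvent_mem ε y⟩ := by
  have h2 : (0 : ℝ) < ε := ε.2
  have hε0 : ((ε : ℝ) : ℂ) ≠ 0 := by exact_mod_cast h2.ne'
  have h := T.resolvent_right ε y
  rw [yosida, smul_apply, sub_apply,
    one_apply_eq_self]
  nth_rewrite 1 [← h]
  rw [add_sub_cancel_left, smul_smul, inv_mul_cancel₀ hε0, one_smul]

/-- The bounded operator `R = (1 + T)⁻¹`. -/
noncomputable def res : H →L[ℂ] H := T.resolvent ⟨1, Set.mem_Ioi.mpr one_pos⟩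

theorem res_nonneg : 0 ≤ T.res := T.resolvent_nonneg _

theorem one_sub_res_nonneg : 0 ≤ 1 - T.res := sub_nonneg.mpr (T.resolvent_le_one _)

/-- The operator `√R` for `R = (1 + T)⁻¹`, that is, `(1 + T)^(-1/2)`. -/
noncomputable def sqrtRes : H →L[ℂ] H := CFC.sqrt T.res

/-- The operator `√(1 - R)` for `R = (1 + T)⁻¹`, that is, `T^(1/2) (1 + T)^(-1/2)`. -/
noncomputable def sqrtOneSubRes : H →L[ℂ] H := CFC.sqrt (1 - T.res)

theorem sqrtRes_sqrtRes (x : H) : T.sqrtRes (T.sqrtRes x) = T.res x := by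
  have := CFC.sqrt_mul_sqrt_self T.res T.res_nonneg
  exact congrArg (fun f : H →L[ℂ] H => f x) this

theorem sqrtOneSubRes_sqrtOneSubRes (x : H) :
    T.sqrtOneSubRes (T.sqrtOneSubRes x) = x - T.res x := by
  have := CFC.sqrt_mul_sqrt_self (1 - T.res) T.one_sub_res_nonneg
  exact congrArg (fun f : H →L[ℂ] H => f x) this

theorem inner_sqrtRes (x y : H) : inner ℂ (T.sqrtRes x) y = inner ℂ x (T.sqrtRes y) :=
  ((ContinuousLinearMap.nonneg_iff_isPositive _).mp (CFC.sqrt_nonneg T.res)).1 x y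

theorem inner_sqrtOneSubRes (x y : H) :
    inner ℂ (T.sqrtOneSubRes x) y = inner ℂ x (T.sqrtOneSubRes y) :=
  ((ContinuousLinearMap.nonneg_iff_isPositive _).mp (CFC.sqrt_nonneg (1 - T.res))).1 x y

theorem sqrt_commute : Commute T.sqrtRes T.sqrtOneSubRes := by
  have h1 : Commute T.res (1 - T.res) := (Commute.one_right _).sub_right (Commute.refl _)
  have h2 : Commute T.sqrtRes (1 - T.res) := (h1.cfcₙ_nnreal NNReal.sqrt)
  exact (h2.symm.cfcₙ_nnreal NNReal.sqrt).symm

theorem sqrt_comm (x : H) :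
    T.sqrtRes (T.sqrtOneSubRes x) = T.sqrtOneSubRes (T.sqrtRes x) :=
  congrArg (fun f : H →L[ℂ] H => f x) T.sqrt_commute

theorem res_left (x : T.toPMap.domain) : T.res ((x : H) + T.toPMap x) = x := by
  have := T.resolvent_left ⟨1, Set.mem_Ioi.mpr one_pos⟩ x
  simp only [Complex.ofReal_one, one_smul] at this
  exact this

theorem res_right (y : H) :
    T.toPMap ⟨T.res y, T.resolvent_mem _ y⟩ = y - T.res y := by
  have := T.resolvent_right ⟨1, Set.mem_Ioi.mpr one_pos⟩ y
  simp only [Complex.ofReal_one, one_smul] at this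
  exact eq_sub_of_add_eq' this

theorem sqrtRes_injective : Function.Injective T.sqrtRes := by
  rw [injective_iff_map_eq_zero]
  intro x hx
  have h : T.res x = 0 := by rw [← sqrtRes_sqrtRes, hx, map_zero]
  have h2 := T.res_right x
  have h3 : T.toPMap ⟨T.res x, T.resolvent_mem _ x⟩ = T.toPMap 0 := T.toPMap_congr (by simpa using h)
  rw [h3, h, LinearPMap.map_zero, sub_zero] at h2
  exact h2.symm

/-- The square root `T^(1/2)` of a positive operator, as an unbounded operator, through the
functional calculus of the bounded operator `R = (1 + T)⁻¹`: its domain is the range of `√R`, and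
`T^(1/2) (√R x) = √(1 - R) x`. -/
noncomputable def sqrtPMap : H →ₗ.[ℂ] H where
  domain := LinearMap.range T.sqrtRes.toLinearMap
  toFun := T.sqrtOneSubRes.toLinearMap ∘ₗ
    (LinearEquiv.ofInjective T.sqrtRes.toLinearMap T.sqrtRes_injective).symm.toLinearMap

theorem sqrtRes_mem (x : H) : T.sqrtRes x ∈ T.sqrtPMap.domain :=
  LinearMap.mem_range_self T.sqrtRes.toLinearMap x

theorem sqrtPMap_apply (x : H) (h : T.sqrtRes x ∈ T.sqrtPMap.domain) :
    T.sqrtPMap ⟨T.sqrtRes x, h⟩ = T.sqrtOneSubRes x :=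
  congrArg T.sqrtOneSubRes
    ((LinearEquiv.ofInjective T.sqrtRes.toLinearMap T.sqrtRes_injective).symm_apply_apply x)

/-- The positive operator `T^(1/2)`. -/
noncomputable def sqrt : PosOp H where
  toPMap := T.sqrtPMap
  isSelfAdjoint := by
    apply LinearPMap.isSelfAdjoint_of_symmetric_of_maximal
    · refine T.isSelfAdjoint.dense_domain.mono (fun x hx => ?_)
      have h := T.res_left ⟨x, hx⟩
      rw [← sqrtRes_sqrtRes] at h
      exact ⟨_, h⟩
    · rintro ⟨_, x, rfl⟩ ⟨_, y, rfl⟩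
      change inner ℂ (T.sqrtPMap ⟨T.sqrtRes x, T.sqrtRes_mem x⟩) (T.sqrtRes y) =
        inner ℂ (T.sqrtRes x) (T.sqrtPMap ⟨T.sqrtRes y, T.sqrtRes_mem y⟩)
      rw [sqrtPMap_apply, sqrtPMap_apply, inner_sqrtOneSubRes, inner_sqrtRes, sqrt_comm]
    · intro y w hw
      have h1 : T.sqrtRes w = T.sqrtOneSubRes y := by
        refine ext_inner_right ℂ (fun x => ?_)
        rw [inner_sqrtRes, inner_sqrtOneSubRes]
        have := hw ⟨_, T.sqrtRes_mem x⟩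
        rwa [sqrtPMap_apply] at this
      have h2 : y = T.sqrtRes (T.sqrtRes y + T.sqrtOneSubRes w) := by
        rw [map_add, sqrtRes_sqrtRes, sqrt_comm, h1, sqrtOneSubRes_sqrtOneSubRes]
        abel
      rw [h2]
      exact T.sqrtRes_mem _
  nonneg := by
    rintro ⟨_, x, rfl⟩
    change 0 ≤ (inner ℂ (T.sqrtRes x) (T.sqrtPMap ⟨T.sqrtRes x, T.sqrtRes_mem x⟩)).re
    rw [sqrtPMap_apply]
    have h := T.sqrt_commute.mul_nonneg (CFC.sqrt_nonneg T.res) (CFC.sqrt_nonneg (1 - T.res))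
    have h2 := ((ContinuousLinearMap.nonneg_iff_isPositive _).mp h).re_inner_nonneg_right x
    rw [inner_sqrtRes]
    exact h2

/-- `T^(1/2)` is the positive square root of `T`: a vector is in the domain of `T` exactly if
`T^(1/2)` can be applied to it twice, and then the result is the value of `T`. -/
theorem sqrt_sqrt (x y : H) :
    (∃ hx : x ∈ T.toPMap.domain, T.toPMap ⟨x, hx⟩ = y) ↔
      ∃ (h : x ∈ T.sqrt.toPMap.domain) (h2 : T.sqrt.toPMap ⟨x, h⟩ ∈ T.sqrt.toPMap.domain),
        T.sqrt.toPMap ⟨T.sqrt.toPMap ⟨x, h⟩, h2⟩ = y := by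
  change _ ↔ ∃ (h : x ∈ T.sqrtPMap.domain) (h2 : T.sqrtPMap ⟨x, h⟩ ∈ T.sqrtPMap.domain),
        T.sqrtPMap ⟨T.sqrtPMap ⟨x, h⟩, h2⟩ = y
  constructor
  · rintro ⟨hx, rfl⟩
    obtain ⟨z, rfl⟩ : ∃ z, T.res z = x := ⟨_, T.res_left ⟨x, hx⟩⟩
    have e1 : T.res z = T.sqrtRes (T.sqrtRes z) := (T.sqrtRes_sqrtRes z).symm
    have m1 : T.res z ∈ T.sqrtPMap.domain := by rw [e1]; exact T.sqrtRes_mem _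
    have e2 : T.sqrtPMap ⟨T.res z, m1⟩ = T.sqrtRes (T.sqrtOneSubRes z) := by
      rw [sqrt_comm, ← T.sqrtPMap_apply (T.sqrtRes z) (T.sqrtRes_mem _)]
      congr 1
      exact Subtype.ext e1
    have m2 : T.sqrtPMap ⟨T.res z, m1⟩ ∈ T.sqrtPMap.domain := by rw [e2]; exact T.sqrtRes_mem _
    refine ⟨m1, m2, ?_⟩
    rw [T.res_right z, ← sqrtOneSubRes_sqrtOneSubRes,
      ← T.sqrtPMap_apply (T.sqrtOneSubRes z) (T.sqrtRes_mem _)]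
    congr 1
    exact Subtype.ext e2
  · rintro ⟨⟨z, rfl⟩, ⟨w, hw⟩, rfl⟩
    have e1 : T.sqrtPMap ⟨T.sqrtRes z, T.sqrtRes_mem z⟩ = T.sqrtOneSubRes z := T.sqrtPMap_apply z _
    have hw2 : T.sqrtRes w = T.sqrtOneSubRes z := hw.trans e1
    have hz : z = T.sqrtRes (T.sqrtRes z + T.sqrtOneSubRes w) := by
      rw [map_add, sqrtRes_sqrtRes, sqrt_comm, hw2, sqrtOneSubRes_sqrtOneSubRes]
      abel
    have hz2 : T.sqrtRes z = T.res (T.sqrtRes z + T.sqrtOneSubRes w) := by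
      conv_lhs => rw [hz]
      rw [sqrtRes_sqrtRes]
    have m : T.sqrtRes z ∈ T.toPMap.domain := by rw [hz2]; exact T.resolvent_mem _ _
    refine ⟨m, ?_⟩
    have e3 : T.toPMap ⟨T.sqrtRes z, m⟩ = T.sqrtOneSubRes w := by
      rw [T.toPMap_congr (y := ⟨_, T.resolvent_mem _ (T.sqrtRes z + T.sqrtOneSubRes w)⟩) hz2]
      refine (T.res_right _).trans ?_
      rw [← hz2]
      abel
    refine e3.trans ?_
    rw [← T.sqrtPMap_apply w (T.sqrtRes_mem w)]
    congr 1
    exact Subtype.ext hw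

end

end PosOp

/-! ### Trace class operators -/

section

variable {H : Type*} [NormedAddCommGroup H] [InnerProductSpace ℂ H] [CompleteSpace H]

variable (H) in
/-- The vectors of a fixed orthonormal basis of `H`. -/
noncomputable def onbSet : Set H := (exists_hilbertBasis ℂ H).choose

variable (H) in
/-- A fixed orthonormal basis of `H`; the traces below do not depend on it. -/
noncomputable def onb : HilbertBasis (onbSet H) ℂ H :=
  (exists_hilbertBasis ℂ H).choose_spec.choose

/-- `A` is trace class: `Tr |A| < ∞`, where `|A| = (A* A)^(1/2)`. -/
def IsTraceClass (A : H →L[ℂ] H) : Prop :=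
  Summable fun i => (inner ℂ (onb H i) (CFC.abs A (onb H i))).re

/-- The trace of a (trace class) operator. -/
noncomputable def opTrace (A : H →L[ℂ] H) : ℂ :=
  ∑' i, inner ℂ (onb H i) (A (onb H i))

variable (H) in
/-- The positive trace class operators. -/
def positiveTraceClass : Set (H →L[ℂ] H) := {γ | 0 ≤ γ ∧ IsTraceClass γ}

theorem isTraceClass_iff_of_nonneg {γ : H →L[ℂ] H} (h : 0 ≤ γ) :
    IsTraceClass γ ↔ Summable fun i => (inner ℂ (onb H i) (γ (onb H i))).re := by
  rw [IsTraceClass, CFC.abs_of_nonneg γ h]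

theorem hasSum_onb_sq (x : H) : HasSum (fun i => ‖inner ℂ (onb H i) x‖ ^ 2) (‖x‖ ^ 2) := by
  have h := Complex.hasSum_re ((onb H).hasSum_inner_mul_inner x x)
  convert h using 1
  · funext i
    rw [← inner_conj_symm x, ← Complex.normSq_eq_conj_mul_self, Complex.ofReal_re,
      Complex.normSq_eq_norm_sq]
  · exact (inner_self_eq_norm_sq (𝕜 := ℂ) x).symm

theorem summable_adjoint_sq (A : H →L[ℂ] H) (h : Summable fun i => ‖A (onb H i)‖ ^ 2) :
    Summable fun i => ‖A.adjoint (onb H i)‖ ^ 2 := by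
  have h1 : Summable fun p : onbSet H × onbSet H =>
      ‖inner ℂ (onb H p.2) (A (onb H p.1))‖ ^ 2 := by
    refine (summable_prod_of_nonneg (fun _ => sq_nonneg _)).mpr
      ⟨fun i => (hasSum_onb_sq (A (onb H i))).summable, ?_⟩
    exact h.congr (fun i => (hasSum_onb_sq (A (onb H i))).tsum_eq.symm)
  have h2 := ((summable_prod_of_nonneg (fun _ => sq_nonneg _)).mp h1.prod_symm).2
  refine h2.congr (fun i => ?_)
  rw [← (hasSum_onb_sq (A.adjoint (onb H i))).tsum_eq]
  refine tsum_congr (fun j => ?_)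
  rw [ContinuousLinearMap.adjoint_inner_right, ← inner_conj_symm, RCLike.norm_conj]
  rfl

/-- The series defining the trace of `B γ` converges absolutely. -/
theorem summable_trace_mul (B : H →L[ℂ] H) {γ : H →L[ℂ] H} (hγ : γ ∈ positiveTraceClass H) :
    Summable fun i => inner ℂ (onb H i) ((B * γ) (onb H i)) := by
  have hs := (isTraceClass_iff_of_nonneg hγ.1).mp hγ.2
  set s := CFC.sqrt γ with hsd
  have hss : ∀ x, s (s x) = γ x := fun x =>
    congrArg (fun f : H →L[ℂ] H => f x) (CFC.sqrt_mul_sqrt_self γ hγ.1)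
  have hsa : ∀ x y, inner ℂ (s x) y = inner ℂ x (s y) :=
    ((ContinuousLinearMap.nonneg_iff_isPositive _).mp (CFC.sqrt_nonneg γ)).1
  have h1 : Summable fun i => ‖s (onb H i)‖ ^ 2 := by
    refine hs.congr (fun i => ?_)
    rw [← hss, ← hsa]
    exact inner_self_eq_norm_sq (𝕜 := ℂ) _
  have h2 : Summable fun i => ‖(B * s) (onb H i)‖ ^ 2 := by
    refine Summable.of_nonneg_of_le (fun _ => by positivity) (fun i => ?_) (h1.mul_left (‖B‖ ^ 2))
    rw [← mul_pow]
    gcongr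
    exact B.le_opNorm _
  have h3 := summable_adjoint_sq _ h2
  refine Summable.of_norm_bounded (h3.add h1) (fun i => ?_)
  have e : inner ℂ (onb H i) ((B * γ) (onb H i)) =
      inner ℂ ((B * s).adjoint (onb H i)) (s (onb H i)) := by
    rw [ContinuousLinearMap.adjoint_inner_left]
    change inner ℂ _ (B (γ _)) = inner ℂ _ (B (s (s _)))
    rw [hss]
  rw [e]
  refine (norm_inner_le_norm _ _).trans ?_
  nlinarith [sq_nonneg (‖(B * s).adjoint (onb H i)‖ - ‖s (onb H i)‖),
    sq_nonneg (‖(B * s).adjoint (onb H i)‖), sq_nonneg ‖s (onb H i)‖]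

theorem positiveTraceClass_zero : (0 : H →L[ℂ] H) ∈ positiveTraceClass H :=
  ⟨le_rfl, (isTraceClass_iff_of_nonneg le_rfl).mpr (by simp)⟩

theorem positiveTraceClass_add {γ δ : H →L[ℂ] H} (hγ : γ ∈ positiveTraceClass H)
    (hδ : δ ∈ positiveTraceClass H) : γ + δ ∈ positiveTraceClass H := by
  have h : 0 ≤ γ + δ := add_nonneg hγ.1 hδ.1
  refine ⟨h, (isTraceClass_iff_of_nonneg h).mpr ?_⟩
  refine (((isTraceClass_iff_of_nonneg hγ.1).mp hγ.2).add
    ((isTraceClass_iff_of_nonneg hδ.1).mp hδ.2)).congr (fun i => ?_)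
  rw [add_apply, inner_add_right, Complex.add_re]

theorem positiveTraceClass_smul {γ : H →L[ℂ] H} (hγ : γ ∈ positiveTraceClass H)
    {c : ℝ} (hc : 0 ≤ c) : c • γ ∈ positiveTraceClass H := by
  have h : 0 ≤ c • γ := smul_nonneg hc hγ.1
  refine ⟨h, (isTraceClass_iff_of_nonneg h).mpr ?_⟩
  refine (((isTraceClass_iff_of_nonneg hγ.1).mp hγ.2).mul_left c).congr (fun i => ?_)
  rw [smul_apply, ← Complex.coe_smul, inner_smul_right, Complex.re_ofReal_mul]

end

namespace PosOp

section

variable {H : Type*} [NormedAddCommGroup H] [InnerProductSpace ℂ H] [CompleteSpace H]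
variable (T : PosOp H)

/-- `Tr(Tγ) = sup_{ε > 0} Tr(T(1 + εT)⁻¹ γ)`, in `[0, ∞]`, for positive trace class `γ`. -/
noncomputable def traceMul (γ : H →L[ℂ] H) : ENNReal :=
  ⨆ ε : Set.Ioi (0 : ℝ), ENNReal.ofReal (opTrace (T.yosida ε * γ)).re

/-- The cone `X⁺` of positive trace class operators `γ` with `Tr(Tγ) < ∞`. -/
def XPlus : Set (H →L[ℂ] H) := {γ | γ ∈ positiveTraceClass H ∧ T.traceMul γ < ⊤}

theorem XPlus_zero : (0 : H →L[ℂ] H) ∈ T.XPlus := by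
  refine ⟨positiveTraceClass_zero, ?_⟩
  simp [traceMul, opTrace]

theorem XPlus_add {γ δ : H →L[ℂ] H} (hγ : γ ∈ T.XPlus) (hδ : δ ∈ T.XPlus) : γ + δ ∈ T.XPlus := by
  refine ⟨positiveTraceClass_add hγ.1 hδ.1, ?_⟩
  refine lt_of_le_of_lt (iSup_le (fun ε => ?_)) (ENNReal.add_lt_top.mpr ⟨hγ.2, hδ.2⟩)
  have e : opTrace (T.yosida ε * (γ + δ)) =
      opTrace (T.yosida ε * γ) + opTrace (T.yosida ε * δ) := by
    rw [opTrace, opTrace, opTrace, ← (summable_trace_mul _ hγ.1).tsum_add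
      (summable_trace_mul _ hδ.1)]
    refine tsum_congr (fun i => ?_)
    rw [mul_add, add_apply, inner_add_right]
  rw [e, Complex.add_re]
  refine ENNReal.ofReal_add_le.trans (add_le_add ?_ ?_)
  · exact le_iSup (fun ε => ENNReal.ofReal (opTrace (T.yosida ε * γ)).re) ε
  · exact le_iSup (fun ε => ENNReal.ofReal (opTrace (T.yosida ε * δ)).re) ε

theorem XPlus_smul {γ : H →L[ℂ] H} (hγ : γ ∈ T.XPlus) {c : ℝ} (hc : 0 ≤ c) :
    c • γ ∈ T.XPlus := by
  refine ⟨positiveTraceClass_smul hγ.1 hc, ?_⟩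
  refine lt_of_le_of_lt (iSup_le (fun ε => ?_))
    (ENNReal.mul_lt_top (ENNReal.ofReal_lt_top (r := c)) hγ.2)
  have e : opTrace (T.yosida ε * (c • γ)) = (c : ℂ) * opTrace (T.yosida ε * γ) := by
    rw [opTrace, opTrace, ← tsum_mul_left]
    refine tsum_congr (fun i => ?_)
    rw [mul_smul_comm, smul_apply, ← Complex.coe_smul, inner_smul_right]
  rw [e, Complex.re_ofReal_mul, ENNReal.ofReal_mul hc]
  gcongr
  exact le_iSup (fun ε => ENNReal.ofReal (opTrace (T.yosida ε * γ)).re) ε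

/-- The real vector space `X = X⁺ - X⁺`. -/
def X : Submodule ℝ (H →L[ℂ] H) where
  carrier := {γ | ∃ γp ∈ T.XPlus, ∃ γm ∈ T.XPlus, γ = γp - γm}
  add_mem' := by
    rintro _ _ ⟨a, ha, b, hb, rfl⟩ ⟨c, hc, d, hd, rfl⟩
    exact ⟨a + c, T.XPlus_add ha hc, b + d, T.XPlus_add hb hd, by abel⟩
  zero_mem' := ⟨0, T.XPlus_zero, 0, T.XPlus_zero, by simp⟩
  smul_mem' := by
    rintro c _ ⟨a, ha, b, hb, rfl⟩
    rcases le_total 0 c with hc | hc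
    · exact ⟨c • a, T.XPlus_smul ha hc, c • b, T.XPlus_smul hb hc, smul_sub c a b⟩
    · refine ⟨(-c) • b, T.XPlus_smul hb (neg_nonneg.mpr hc),
        (-c) • a, T.XPlus_smul ha (neg_nonneg.mpr hc), ?_⟩
      rw [smul_sub, neg_smul, neg_smul]
      abel

/-- The norm of `X` as an extended real: the infimum of `Tr((1 + T)γ⁺) + Tr((1 + T)γ⁻)` over all
decompositions `γ = γ⁺ - γ⁻` into positive trace class operators. -/
noncomputable def extNormX (γ : H →L[ℂ] H) : ENNReal :=
  ⨅ (γp ∈ positiveTraceClass H) (γm ∈ positiveTraceClass H) (_ : γ = γp - γm),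
    T.oneAdd.traceMul γp + T.oneAdd.traceMul γm

/-- The norm of `X`. -/
noncomputable def normX (γ : T.X) : ℝ := (T.extNormX (γ : H →L[ℂ] H)).toReal

theorem normX_nonneg (γ : T.X) : 0 ≤ T.normX γ := ENNReal.toReal_nonneg

/-- The dual space `X*`: the linear functionals on `X` that are bounded with respect to the norm
of `X`. -/
def dualX : Submodule ℝ (T.X →ₗ[ℝ] ℝ) where
  carrier := {ω | ∃ C > 0, ∀ γ, |ω γ| ≤ C * T.normX γ}
  add_mem' := by
    rintro ω η ⟨C, hC, h⟩ ⟨D, hD, k⟩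
    refine ⟨C + D, add_pos hC hD, fun γ => ?_⟩
    rw [LinearMap.add_apply, add_mul]
    exact (abs_add_le _ _).trans (add_le_add (h γ) (k γ))
  zero_mem' := ⟨1, one_pos, fun γ => by simpa using T.normX_nonneg γ⟩
  smul_mem' := by
    rintro c ω ⟨C, hC, h⟩
    refine ⟨(|c| + 1) * C, by positivity, fun γ => ?_⟩
    rw [LinearMap.smul_apply, smul_eq_mul, abs_mul, mul_assoc]
    refine mul_le_mul (by linarith) (h γ) (abs_nonneg _) (by positivity)

/-- The norm of `X*`: the supremum of `|ω(γ)| / ‖γ‖_X`. (The quotient is `0` at `γ = 0`.) -/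
noncomputable def normDual (ω : T.X →ₗ[ℝ] ℝ) : ℝ := ⨆ γ : T.X, |ω γ| / T.normX γ

/-! ### Sesquilinear forms on the form domain -/

/-- The form domain `Q(T)`, the domain of `T^(1/2)`. -/
noncomputable def formDomain : Submodule ℂ H := T.sqrt.toPMap.domain

/-- The sesquilinear form `t` associated with `T`: `t(ψ, φ) = ⟨T^(1/2) ψ, T^(1/2) φ⟩`. -/
noncomputable def form (ψ φ : T.formDomain) : ℂ :=
  inner ℂ (T.sqrt.toPMap ψ) (T.sqrt.toPMap φ)

/-- `‖ψ‖_T² = ‖ψ‖² + ‖T^(1/2) ψ‖²`. -/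
noncomputable def normSqT (ψ : T.formDomain) : ℝ := ‖(ψ : H)‖ ^ 2 + ‖T.sqrt.toPMap ψ‖ ^ 2

theorem normSqT_nonneg (ψ : T.formDomain) : 0 ≤ T.normSqT ψ := by
  unfold normSqT; positivity

/-- Sesquilinear forms on `Q(T)`, antilinear in the first argument and linear in the second. -/
abbrev SesqForm : Type _ := T.formDomain →ₗ⋆[ℂ] T.formDomain →ₗ[ℂ] ℂ

/-- The space `F(T)` of Hermitian sesquilinear forms `v` on `Q(T)` for which there is `C > 0` with
`|v(ψ, ψ)| ≤ C ‖ψ‖_T²`. -/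
def formSpace : Submodule ℝ T.SesqForm where
  carrier := {v | (∀ ψ φ, v ψ φ = starRingEnd ℂ (v φ ψ)) ∧
    ∃ C > 0, ∀ ψ, ‖v ψ ψ‖ ≤ C * T.normSqT ψ}
  add_mem' := by
    rintro v w ⟨hv, C, hC, h⟩ ⟨hw, D, hD, k⟩
    refine ⟨fun ψ φ => ?_, C + D, add_pos hC hD, fun ψ => ?_⟩
    · simp only [LinearMap.add_apply, map_add]
      rw [hv ψ φ, hw ψ φ]
    · simp only [LinearMap.add_apply, add_mul]
      exact (norm_add_le _ _).trans (add_le_add (h ψ) (k ψ))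
  zero_mem' := ⟨fun ψ φ => by simp, 1, one_pos, fun ψ => by simpa using T.normSqT_nonneg ψ⟩
  smul_mem' := by
    rintro c v ⟨hv, C, hC, h⟩
    refine ⟨fun ψ φ => ?_, (|c| + 1) * C, by positivity, fun ψ => ?_⟩
    · simp only [LinearMap.smul_apply, Complex.real_smul, map_mul, Complex.conj_ofReal]
      rw [hv ψ φ]
    · simp only [LinearMap.smul_apply, norm_smul, Real.norm_eq_abs]
      rw [mul_assoc]
      exact mul_le_mul (by linarith) (h ψ) (norm_nonneg _) (by positivity)

/-- The norm of `F(T)`: the supremum of `|v(ψ, ψ)| / ‖ψ‖_T²`. (The quotient is `0` at `ψ = 0`.) -/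
noncomputable def normForm (v : T.SesqForm) : ℝ := ⨆ ψ : T.formDomain, ‖v ψ ψ‖ / T.normSqT ψ

/-- `v` is relatively bounded with respect to the form `t` of `T`, with constants `a` and `b`:
`|v(ψ, ψ)| ≤ a t(ψ, ψ) + b ‖ψ‖²`. -/
def HasRelBound (v : T.SesqForm) (a b : ℝ) : Prop :=
  0 ≤ a ∧ 0 ≤ b ∧ ∀ ψ, ‖v ψ ψ‖ ≤ a * (T.form ψ ψ).re + b * ‖(ψ : H)‖ ^ 2

/-- `C` is the form sum of `T` and `v`: it is self-adjoint and lower semibounded, and the form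
associated with it is `t + v` with domain `Q(T)`. Here the form associated with a self-adjoint
operator `C` with lower bound `μ` has as its domain the domain of `(C - μ)^(1/2)`, and it is
`⟨(C - μ)^(1/2) ψ, (C - μ)^(1/2) φ⟩ + μ ⟨ψ, φ⟩`. -/
def IsFormSum (v : T.SesqForm) (C : H →ₗ.[ℂ] H) : Prop :=
  ∃ (hC : IsSelfAdjoint C) (μ : ℝ) (hμ : IsLowerBound C μ)
    (hQ : (subLowerBound C hC μ hμ).formDomain = T.formDomain),
    ∀ ψ φ : T.formDomain,
      (subLowerBound C hC μ hμ).form ⟨ψ, hQ.ge ψ.2⟩ ⟨φ, hQ.ge φ.2⟩ + μ * inner ℂ (ψ : H) (φ : H) =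
        T.form ψ φ + v ψ φ

end

end PosOp

/-! The proof evaluates every trace along the vectors s_i = √γ e_i, where (e_i) is the fixed
orthonormal basis. For positive trace class γ, cyclicity of the trace for Hilbert–Schmidt operators
gives Tr(Bγ) = ∑ ⟨s_i, B s_i⟩ for bounded B (`hasSum_opTrace_mul`). If B = V(1+εV)⁻¹, the terms are
nonnegative, stay below ‖V^(1/2) s_i‖² and converge to it as ε → 0. Hence Tr(Vγ) < ∞ holds exactly
if all s_i lie in Q(V) and ∑ ‖V^(1/2) s_i‖² < ∞, and this sum is then the trace (`hasSum_traceMul`).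
In particular Tr((1+T)γ) = ∑ ‖s_i‖_T².

A functional ω gives a form v_ω by polarization, with v_ω(ψ,ψ) = ω(|ψ⟩⟨ψ|). Conversely v_ω
determines ω: by Bessel's inequality, γ minus finitely many |s_i⟩⟨s_i| stays in X⁺, and its X-norm
is at most a tail of ∑ ‖s_i‖_T², so ω(γ) = ∑ v_ω(s_i, s_i) (`hasSum_dualX`, `hasSum_dualToForm`).
This yields injectivity and, by termwise comparison with ∑ ‖s_i‖_T², one half of the isometry. The
other half is ‖|ψ⟩⟨ψ|‖_X ≤ ‖ψ‖_T².

For surjectivity, scale v until its relative bound is below one. The KLMN theorem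
(`exists_isFormSum`) gives the form sum C of T and cv, and c v(ψ,ψ) is the form of C - μ minus that
of T plus μ‖ψ‖². Summed over the s_i this is the asserted trace formula (`IsFormSum.hasSum`), whose
right side defines a bounded functional with form v. For an arbitrary admissible scale the formula
follows because both sides are the sum of the same series ∑ v(s_i, s_i).

KLMN itself rests on the fact that (1+T)^(-1/2) is unitary from H onto Q(T) with the norm ‖·‖_T: a
bounded coercive form on Q(T) becomes an invertible bounded operator B on H, and the desired
operator is the inverse of (1+T)^(-1/2) B⁻¹ (1+T)^(-1/2). -/

open Filter Topology

namespace PosOp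

section

variable {H : Type*} [NormedAddCommGroup H] [InnerProductSpace ℂ H] [CompleteSpace H]
variable (V : PosOp H)

/-- The positive sequence `1 / (n + 1)`. -/
noncomputable def eps (n : ℕ) : Set.Ioi (0 : ℝ) :=
  ⟨1 / ((n : ℝ) + 1), Set.mem_Ioi.mpr (by positivity)⟩

theorem tendsto_eps : Tendsto (fun n => (eps n : ℝ)) atTop (𝓝 0) :=
  tendsto_one_div_add_atTop_nhds_zero_nat

/-! ### The resolvent -/

theorem norm_resolvent_le (ε : Set.Ioi (0 : ℝ)) (y : H) : ‖V.resolvent ε y‖ ≤ ‖y‖ := by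
  have h := V.norm_le_oneAddSMul ε ⟨_, V.resolvent_mem ε y⟩
  rwa [oneAddSMul_apply, V.resolvent_right] at h

theorem norm_sub_resolvent_le (ε : Set.Ioi (0 : ℝ)) (x : V.toPMap.domain) :
    ‖V.resolvent ε x - x‖ ≤ ε * ‖V.toPMap x‖ := by
  have h := V.resolvent_left ε x
  rw [map_add, map_smul] at h
  have h2 : V.resolvent ε x - x = -(((ε : ℝ) : ℂ) • V.resolvent ε (V.toPMap x)) := by
    nth_rewrite 2 [← h]
    abel
  rw [h2, norm_neg, norm_smul, Complex.norm_real, Real.norm_of_nonneg (le_of_lt ε.2)]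
  exact mul_le_mul_of_nonneg_left (V.norm_resolvent_le _ _) (le_of_lt ε.2)

/-- On the dense domain the error is at most ε‖Vx‖, and the resolvents are contractions, so strong
convergence extends to all of H. -/
theorem tendsto_resolvent (y : H) :
    Tendsto (fun n => V.resolvent (eps n) y) atTop (𝓝 y) := by
  rw [Metric.tendsto_atTop']
  intro δ hδ
  obtain ⟨x, hx, hxy⟩ := Metric.dense_iff.mp V.isSelfAdjoint.dense_domain y (δ / 3) (by positivity)
  rw [Metric.mem_ball, dist_eq_norm] at hx
  have h1 : Tendsto (fun n => (eps n : ℝ) * ‖V.toPMap ⟨x, hxy⟩‖) atTop (𝓝 0) := by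
    simpa using tendsto_eps.mul_const ‖V.toPMap ⟨x, hxy⟩‖
  obtain ⟨N, hN⟩ := eventually_atTop.mp (h1.eventually_lt_const (show (0 : ℝ) < δ / 3 by positivity))
  refine ⟨N, fun n hn => ?_⟩
  have h2 := V.norm_sub_resolvent_le (eps n) ⟨x, hxy⟩
  have h3 := hN n hn.le
  have h4 := V.norm_resolvent_le (eps n) (x - y)
  rw [dist_eq_norm]
  have e : V.resolvent (eps n) y - y =
      (V.resolvent (eps n) x - x) - V.resolvent (eps n) (x - y) + (x - y) := by
    rw [map_sub]; abel
  rw [e]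
  refine (norm_add_le _ _).trans_lt ?_
  have h5 := norm_sub_le (V.resolvent (eps n) x - x) (V.resolvent (eps n) (x - y))
  simp only at h2
  linarith

/-- With R = (1+V)⁻¹ and R_ε = (1+εV)⁻¹, both (1-ε) R_ε R + ε R_ε and (1-ε) R R_ε + ε R_ε equal R.
The common factor 1-ε can be cancelled unless ε = 1, when R_ε = R. Commutation then passes to √R and
√(1-R), from which V^(1/2) is built. -/
theorem resolvent_commute_res (ε : Set.Ioi (0 : ℝ)) : Commute (V.resolvent ε) V.res := by
  have hε : ((ε : ℝ) : ℂ) ≠ 0 := by exact_mod_cast (ne_of_gt ε.2)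
  have h1 : ∀ y, V.res y = (1 - ((ε : ℝ) : ℂ)) • V.resolvent ε (V.res y) +
      ((ε : ℝ) : ℂ) • V.resolvent ε y := by
    intro y
    have h := V.resolvent_left ε ⟨V.res y, V.resolvent_mem _ y⟩
    rw [V.res_right] at h
    refine h.symm.trans ?_
    simp only [map_add, map_smul, map_sub, smul_sub, sub_smul, one_smul]
    abel
  have h2 : ∀ y, V.res y = (1 - ((ε : ℝ) : ℂ)) • V.res (V.resolvent ε y) +
      ((ε : ℝ) : ℂ) • V.resolvent ε y := by
    intro y
    have h := V.res_left ⟨V.resolvent ε y, V.resolvent_mem _ y⟩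
    have h3 := V.resolvent_right ε y
    rw [map_add] at h
    have h4 := congrArg V.res h3
    rw [map_add, map_smul] at h4
    rw [← h4]
    have h5 := congrArg (fun z => ((ε : ℝ) : ℂ) • z) h
    simp only [smul_add] at h5
    rw [← h5, sub_smul, one_smul]
    abel
  by_cases h : (1 - ((ε : ℝ) : ℂ)) = 0
  · have h3 : ε = ⟨1, Set.mem_Ioi.mpr one_pos⟩ := by
      apply Subtype.ext
      have : ((ε : ℝ) : ℂ) = 1 := (sub_eq_zero.mp h).symm
      exact_mod_cast this
    rw [h3]
    exact Commute.refl _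
  · ext y
    have h3 := (h1 y).symm.trans (h2 y)
    exact smul_right_injective H h (add_right_cancel h3)

theorem resolvent_sqrtRes (ε : Set.Ioi (0 : ℝ)) (x : H) :
    V.resolvent ε (V.sqrtRes x) = V.sqrtRes (V.resolvent ε x) :=
  congrArg (fun f : H →L[ℂ] H => f x)
    ((V.resolvent_commute_res ε).symm.cfcₙ_nnreal NNReal.sqrt).symm

theorem resolvent_sqrtOneSubRes (ε : Set.Ioi (0 : ℝ)) (x : H) :
    V.resolvent ε (V.sqrtOneSubRes x) = V.sqrtOneSubRes (V.resolvent ε x) :=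
  congrArg (fun f : H →L[ℂ] H => f x)
    ((((Commute.one_right _).sub_right (V.resolvent_commute_res ε)).symm.cfcₙ_nnreal
      NNReal.sqrt).symm)

/-! ### The form of a positive operator -/

/-- `V^(1/2)` as a linear map on the form domain. -/
noncomputable def sqrtForm : V.formDomain →ₗ[ℂ] H := V.sqrt.toPMap.toFun

theorem form_eq (ψ φ : V.formDomain) : V.form ψ φ = inner ℂ (V.sqrtForm ψ) (V.sqrtForm φ) := rfl

theorem normSqT_eq (ψ : V.formDomain) : V.normSqT ψ = ‖(ψ : H)‖ ^ 2 + ‖V.sqrtForm ψ‖ ^ 2 := rfl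

theorem sqrt_symm (ψ φ : V.formDomain) :
    inner ℂ (V.sqrtForm ψ) (φ : H) = inner ℂ (ψ : H) (V.sqrtForm φ) :=
  LinearPMap.symmetric_of_isSelfAdjoint V.sqrt.isSelfAdjoint ψ φ

theorem domain_le_formDomain : V.toPMap.domain ≤ V.formDomain := fun x hx =>
  ((V.sqrt_sqrt x _).mp ⟨hx, rfl⟩).1

theorem resolvent_mem_formDomain (ε : Set.Ioi (0 : ℝ)) (y : H) : V.resolvent ε y ∈ V.formDomain :=
  V.domain_le_formDomain (V.resolvent_mem ε y)

/-- The first representation theorem: the operator `V` is determined by its form. -/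
theorem mem_domain_iff_form (x y : H) :
    (∃ hx : x ∈ V.toPMap.domain, V.toPMap ⟨x, hx⟩ = y) ↔
      ∃ hx : x ∈ V.formDomain, ∀ φ : V.formDomain, V.form φ ⟨x, hx⟩ = inner ℂ (φ : H) y := by
  rw [sqrt_sqrt]
  constructor
  · rintro ⟨h1, h2, rfl⟩
    exact ⟨h1, fun φ => V.sqrt_symm φ ⟨_, h2⟩⟩
  · rintro ⟨h1, h2⟩
    refine ⟨h1, LinearPMap.mem_domain_of_isSelfAdjoint V.sqrt.isSelfAdjoint _ _ (fun φ => ?_)⟩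
    have : inner ℂ (V.sqrt.toPMap φ) (V.sqrt.toPMap ⟨x, h1⟩) = inner ℂ (φ : H) y := h2 φ
    rw [← inner_conj_symm y, ← this, inner_conj_symm]

theorem form_apply_domain (φ : V.formDomain) (x : V.toPMap.domain) :
    V.form φ ⟨x, V.domain_le_formDomain x.2⟩ = inner ℂ (φ : H) (V.toPMap x) :=
  ((V.mem_domain_iff_form x _).mp ⟨x.2, rfl⟩).choose_spec φ

theorem form_self (ψ : V.formDomain) : V.form ψ ψ = ((‖V.sqrtForm ψ‖ ^ 2 : ℝ) : ℂ) := by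
  rw [form_eq, inner_self_eq_norm_sq_to_K]
  norm_cast

theorem form_self_re (ψ : V.formDomain) : (V.form ψ ψ).re = ‖V.sqrtForm ψ‖ ^ 2 := by
  rw [form_self, Complex.ofReal_re]

theorem sqrt_resolvent (ε : Set.Ioi (0 : ℝ)) (ψ : V.formDomain) :
    V.sqrtForm ⟨V.resolvent ε ψ, V.resolvent_mem_formDomain ε ψ⟩ =
      V.resolvent ε (V.sqrtForm ψ) := by
  obtain ⟨_, x, rfl⟩ := ψ
  have e : V.sqrtForm ⟨V.sqrtRes x, V.sqrtRes_mem x⟩ = V.sqrtOneSubRes x :=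
    V.sqrtPMap_apply x _
  have e2 : V.sqrtForm ⟨V.sqrtRes (V.resolvent ε x), V.sqrtRes_mem _⟩ =
    V.sqrtOneSubRes (V.resolvent ε x) := V.sqrtPMap_apply _ _
  refine (V.sqrt.toPMap_congr (V.resolvent_sqrtRes ε x)).trans (e2.trans ?_)
  rw [← resolvent_sqrtOneSubRes]
  exact congrArg _ e.symm

/-- Half of V is moved to the left factor, and V^(1/2) commutes with the resolvent. The right side
makes the bound by ‖V^(1/2)ψ‖² and the limit as ε → 0 immediate. -/
theorem inner_yosida (ε : Set.Ioi (0 : ℝ)) (ψ : V.formDomain) :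
    inner ℂ (ψ : H) (V.yosida ε ψ) =
      inner ℂ (V.sqrtForm ψ) (V.resolvent ε (V.sqrtForm ψ)) := by
  rw [yosida_apply, ← V.form_apply_domain ψ ⟨_, V.resolvent_mem ε ψ⟩, form_eq]
  congr 1
  exact V.sqrt_resolvent ε ψ

/-- Let Y = V(1+εV)⁻¹ = V R_ε. Since x = R_ε x + εYx, the right side is ‖V^(1/2) R_ε x‖² + ε‖Yx‖².
No membership of x in the form domain is needed, which lets this bound prove such membership. -/
theorem inner_yosida_nonneg (ε : Set.Ioi (0 : ℝ)) (x : H) :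
    ‖V.sqrtForm ⟨V.resolvent ε x, V.resolvent_mem_formDomain ε x⟩‖ ^ 2 ≤
      (inner ℂ x (V.yosida ε x)).re := by
  rw [← V.form_self_re, V.form_apply_domain _ ⟨_, V.resolvent_mem ε x⟩, ← V.yosida_apply]
  have h := V.resolvent_right ε x
  rw [← V.yosida_apply] at h
  have h2 : (0 : ℝ) < ε := ε.2
  have h3 : (inner ℂ (V.yosida ε x) (V.yosida ε x)).re = ‖V.yosida ε x‖ ^ 2 :=
    inner_self_eq_norm_sq (𝕜 := ℂ) _
  have h4 : (inner ℂ x (V.yosida ε x)).re =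
      (inner ℂ (V.resolvent ε x + ((ε : ℝ) : ℂ) • V.yosida ε x) (V.yosida ε x)).re := by rw [h]
  rw [h4, inner_add_left, inner_smul_left, Complex.conj_ofReal, Complex.add_re,
    Complex.re_ofReal_mul, h3]
  have : 0 ≤ (ε : ℝ) * ‖V.yosida ε x‖ ^ 2 := by positivity
  simp only
  linarith

theorem re_inner_yosida_nonneg (ε : Set.Ioi (0 : ℝ)) (x : H) :
    0 ≤ (inner ℂ x (V.yosida ε x)).re :=
  (sq_nonneg _).trans (V.inner_yosida_nonneg ε x)

theorem norm_inner_yosida_le (ε : Set.Ioi (0 : ℝ)) (ψ : V.formDomain) :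
    ‖inner ℂ (ψ : H) (V.yosida ε ψ)‖ ≤ ‖V.sqrtForm ψ‖ ^ 2 := by
  rw [inner_yosida, sq]
  exact (norm_inner_le_norm _ _).trans
    (mul_le_mul_of_nonneg_left (V.norm_resolvent_le _ _) (norm_nonneg _))

theorem tendsto_inner_yosida (ψ : V.formDomain) :
    Tendsto (fun n => inner ℂ (ψ : H) (V.yosida (eps n) ψ)) atTop
      (𝓝 ((‖V.sqrtForm ψ‖ ^ 2 : ℝ) : ℂ)) := by
  simp only [inner_yosida]
  rw [← form_self, form_eq]
  exact tendsto_const_nhds.inner (V.tendsto_resolvent _)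

/-- A vector on which the quadratic forms of `V (1 + εV)⁻¹` stay bounded is in the form domain. -/
theorem mem_formDomain_of_le (ψ : H) (M : ℝ)
    (h : ∀ n, (inner ℂ ψ (V.yosida (eps n) ψ)).re ≤ M) : ψ ∈ V.formDomain := by
  have hM : 0 ≤ M := (V.re_inner_yosida_nonneg (eps 0) ψ).trans (h 0)
  -- Replacing ψ by its resolvent regularization allows V^(1/2) to be moved to the left factor,
  -- where its norm is at most √M. In the limit ψ lies in the domain of the adjoint of V^(1/2),
  -- which is V^(1/2) itself.
  have key : ∀ φ : V.formDomain, ‖inner ℂ ψ (V.sqrtForm φ)‖ ≤ √M * ‖(φ : H)‖ := by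
    intro φ
    have h1 : Tendsto (fun n => ‖inner ℂ (V.resolvent (eps n) ψ) (V.sqrtForm φ)‖) atTop
        (𝓝 ‖inner ℂ ψ (V.sqrtForm φ)‖) :=
      ((V.tendsto_resolvent ψ).inner tendsto_const_nhds).norm
    refine le_of_tendsto' h1 (fun n => ?_)
    have h2 := V.sqrt_symm ⟨_, V.resolvent_mem_formDomain (eps n) ψ⟩ φ
    simp only at h2
    rw [← h2]
    refine (norm_inner_le_norm _ _).trans (mul_le_mul_of_nonneg_right ?_ (norm_nonneg _))
    exact Real.le_sqrt_of_sq_le ((V.inner_yosida_nonneg (eps n) ψ).trans (h n))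
  have h2 : ψ ∈ V.sqrt.toPMap.adjoint.domain := by
    rw [LinearPMap.mem_adjoint_domain_iff]
    exact (LinearMap.mkContinuous _ (√M) key).continuous
  rwa [LinearPMap.isSelfAdjoint_def.mp V.sqrt.isSelfAdjoint] at h2

/-! ### Closedness and approximation in form norms -/

/-- The square root is a closed operator. -/
theorem sqrt_closed {u : ℕ → V.formDomain} {ψ χ : H}
    (h1 : Tendsto (fun n => (u n : H)) atTop (𝓝 ψ))
    (h2 : Tendsto (fun n => V.sqrtForm (u n)) atTop (𝓝 χ)) :
    ∃ h : ψ ∈ V.formDomain, V.sqrtForm ⟨ψ, h⟩ = χ := by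
  have hc : IsClosed (V.sqrt.toPMap.graph : Set (H × H)) := V.sqrt.isSelfAdjoint.isClosed
  have := hc.mem_of_tendsto (h1.prodMk_nhds h2)
    (Eventually.of_forall (fun n => V.sqrt.toPMap.mem_graph (u n)))
  obtain ⟨x, hx1, hx2⟩ := (LinearPMap.mem_graph_iff _).mp this
  simp only at hx1 hx2
  subst hx1
  exact ⟨x.2, hx2⟩

/-- If the form of `W` is bounded by the form of `V` on a subspace `D`, then a vector that is
approximated from `D` in the form norm of `V` is approximated in the form norm of `W`. -/
theorem tendsto_sqrt_of_bound {W : PosOp H} (D : Submodule ℂ H) (hV : D ≤ V.formDomain)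
    (hW : D ≤ W.formDomain) (c : ℝ)
    (hc : ∀ x : D, ‖W.sqrtForm ⟨x, hW x.2⟩‖ ^ 2 ≤ c * V.normSqT ⟨x, hV x.2⟩)
    {u : ℕ → D} {ψ χ : H} (h1 : Tendsto (fun n => (u n : H)) atTop (𝓝 ψ))
    (h2 : Tendsto (fun n => V.sqrtForm ⟨u n, hV (u n).2⟩) atTop (𝓝 χ)) :
    ∃ h : ψ ∈ W.formDomain, Tendsto (fun n => W.sqrtForm ⟨u n, hW (u n).2⟩) atTop
      (𝓝 (W.sqrtForm ⟨ψ, h⟩)) := by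
  have hsub : ∀ (Z : PosOp H) (hZ : D ≤ Z.formDomain) (x y : D),
      Z.sqrtForm ⟨x, hZ x.2⟩ - Z.sqrtForm ⟨y, hZ y.2⟩ =
        Z.sqrtForm ⟨(x - y : D), hZ (x - y).2⟩ := fun Z hZ x y =>
    (Z.sqrtForm.map_sub ⟨x, hZ x.2⟩ ⟨y, hZ y.2⟩).symm
  have hcau : CauchySeq (fun n => W.sqrtForm ⟨u n, hW (u n).2⟩) := by
    rw [Metric.cauchySeq_iff']
    intro δ hδ
    have hC : (0 : ℝ) < |c| + 1 := by positivity
    -- Chosen so that (|c|+1)(η² + η²) < δ² = 4(|c|+1)²η². The absolute value is there because c is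
    -- not assumed nonnegative.
    set η : ℝ := δ / (2 * (|c| + 1)) with hη
    have hη0 : 0 < η := by positivity
    obtain ⟨N₂, hN₂⟩ := Metric.cauchySeq_iff.mp h1.cauchySeq η hη0
    obtain ⟨N₃, hN₃⟩ := Metric.cauchySeq_iff.mp h2.cauchySeq η hη0
    refine ⟨max N₂ N₃, fun n hn => ?_⟩
    have e1 := hN₂ n ((le_max_left _ _).trans hn) _ (le_max_left N₂ N₃)
    have e2 := hN₃ n ((le_max_right _ _).trans hn) _ (le_max_right N₂ N₃)
    rw [dist_eq_norm] at e1 e2 ⊢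
    rw [hsub] at e2 ⊢
    have e3 := hc (u n - u (max N₂ N₃))
    rw [normSqT_eq] at e3
    have e4 : ‖((u n - u (max N₂ N₃) : D) : H)‖ < η := e1
    simp only at e3
    refine lt_of_pow_lt_pow_left₀ 2 hδ.le ?_
    have e5 : ‖((u n - u (max N₂ N₃) : D) : H)‖ ^ 2 ≤ η ^ 2 := by gcongr
    have e6 : ‖V.sqrtForm ⟨((u n - u (max N₂ N₃) : D) : H),
      hV (u n - u (max N₂ N₃)).2⟩‖ ^ 2 ≤ η ^ 2 := by gcongr
    have e7 : δ = η * (2 * (|c| + 1)) := by rw [hη]; field_simp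
    have e8 : c ≤ |c| + 1 := (le_abs_self c).trans (by linarith)
    set p := ‖((u n - u (max N₂ N₃) : D) : H)‖ ^ 2
    set q := ‖V.sqrtForm ⟨((u n - u (max N₂ N₃) : D) : H), hV (u n - u (max N₂ N₃)).2⟩‖ ^ 2
    have hp : 0 ≤ p := sq_nonneg _
    have hq : 0 ≤ q := sq_nonneg _
    calc _ ≤ c * (p + q) := e3
      _ ≤ (|c| + 1) * (η ^ 2 + η ^ 2) := by gcongr
      _ < δ ^ 2 := by
        rw [e7]
        have : 1 ≤ |c| + 1 := by linarith [abs_nonneg c]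
        nlinarith [mul_pos hC (pow_pos hη0 2), mul_pos (mul_pos hC hC) (pow_pos hη0 2)]
  obtain ⟨ξ, hξ⟩ := cauchySeq_tendsto_of_complete hcau
  obtain ⟨h, h'⟩ := W.sqrt_closed (u := fun n => ⟨u n, hW (u n).2⟩) h1 hξ
  exact ⟨h, by rw [h']; exact hξ⟩

/-- Every vector of the form domain is approximated by vectors of the domain in the form norm. -/
theorem exists_core_seq (ψ : V.formDomain) :
    ∃ u : ℕ → V.toPMap.domain, Tendsto (fun n => (u n : H)) atTop (𝓝 ψ) ∧
      Tendsto (fun n => V.sqrtForm ⟨u n, V.domain_le_formDomain (u n).2⟩) atTop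
        (𝓝 (V.sqrtForm ψ)) := by
  refine ⟨fun n => ⟨V.resolvent (eps n) ψ, V.resolvent_mem _ _⟩, V.tendsto_resolvent ψ, ?_⟩
  exact (V.tendsto_resolvent (V.sqrtForm ψ)).congr (fun n => (V.sqrt_resolvent (eps n) ψ).symm)

/-- If `W = V + s` on the common domain, then the form domains agree and the forms differ by
`s ‖ψ‖²`. -/
theorem form_of_shift_aux {W : PosOp H} (s : ℝ) (hd : V.toPMap.domain ≤ W.toPMap.domain)
    (hs : ∀ x : V.toPMap.domain,
      W.toPMap ⟨x, hd x.2⟩ = V.toPMap x + (s : ℂ) • (x : H)) (ψ : V.formDomain) :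
    ∃ h : (ψ : H) ∈ W.formDomain,
      ‖W.sqrtForm ⟨ψ, h⟩‖ ^ 2 = ‖V.sqrtForm ψ‖ ^ 2 + s * ‖(ψ : H)‖ ^ 2 := by
  have key : ∀ x : V.toPMap.domain,
      ‖W.sqrtForm ⟨x, (hd.trans W.domain_le_formDomain) x.2⟩‖ ^ 2 =
        ‖V.sqrtForm ⟨x, V.domain_le_formDomain x.2⟩‖ ^ 2 + s * ‖(x : H)‖ ^ 2 := by
    intro x
    rw [← form_self_re, ← form_self_re, V.form_apply_domain _ x,
      W.form_apply_domain _ ⟨x, hd x.2⟩, hs, inner_add_right, inner_smul_right, Complex.add_re,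
      Complex.re_ofReal_mul]
    congr 2
    exact inner_self_eq_norm_sq (𝕜 := ℂ) _
  -- The identity `key` on the operator domain passes to ψ: the approximating sequence converges in
  -- the form norm of V, and by `key` also in that of W.
  obtain ⟨u, hu1, hu2⟩ := V.exists_core_seq ψ
  obtain ⟨h, h'⟩ := V.tendsto_sqrt_of_bound (W := W) V.toPMap.domain V.domain_le_formDomain
    (hd.trans W.domain_le_formDomain) (1 + |s|) (fun x => by
      rw [key x, normSqT_eq]
      have := le_abs_self s
      simp only
      nlinarith [sq_nonneg ‖V.sqrtForm ⟨x, V.domain_le_formDomain x.2⟩‖, sq_nonneg ‖(x : H)‖,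
        mul_nonneg (abs_nonneg s) (sq_nonneg ‖V.sqrtForm ⟨x, V.domain_le_formDomain x.2⟩‖),
        mul_nonneg (sub_nonneg.mpr this) (sq_nonneg ‖(x : H)‖)]) hu1 hu2
  refine ⟨h, tendsto_nhds_unique (h'.norm.pow 2) ?_⟩
  refine Tendsto.congr (fun n => (key (u n)).symm) ?_
  exact (hu2.norm.pow 2).add ((hu1.norm.pow 2).const_mul s)

theorem formDomain_eq_of_shift {W : PosOp H} (s : ℝ) (hd : W.toPMap.domain = V.toPMap.domain)
    (hs : ∀ x : V.toPMap.domain,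
      W.toPMap ⟨x, hd.ge x.2⟩ = V.toPMap x + (s : ℂ) • (x : H)) :
    W.formDomain = V.formDomain := by
  refine le_antisymm (fun ψ hψ => ?_) (fun ψ hψ => ?_)
  · refine (W.form_of_shift_aux (W := V) (-s) hd.le (fun x => ?_) ⟨ψ, hψ⟩).1
    have := hs ⟨x, hd.le x.2⟩
    simp only [Subtype.coe_eta] at this
    rw [this, Complex.ofReal_neg, neg_smul, add_neg_cancel_right]
  · exact (V.form_of_shift_aux s hd.ge hs ⟨ψ, hψ⟩).1

end

end PosOp

section

variable {H : Type*} [NormedAddCommGroup H] [InnerProductSpace ℂ H] [CompleteSpace H]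

/-! ### Traces -/

/-- `Tr (A B) = Tr (B A)` for Hilbert–Schmidt operators `A` and `B`. -/
theorem tsum_inner_adjoint_comm (A B : H →L[ℂ] H) (hA : Summable fun i => ‖A (onb H i)‖ ^ 2)
    (hB : Summable fun i => ‖B (onb H i)‖ ^ 2) :
    ∑' i, inner ℂ (A.adjoint (onb H i)) (B (onb H i)) =
      ∑' i, inner ℂ (B.adjoint (onb H i)) (A (onb H i)) := by
  have h1 : ∀ C : H →L[ℂ] H, Summable (fun i => ‖C (onb H i)‖ ^ 2) →
      Summable fun p : onbSet H × onbSet H => ‖inner ℂ (onb H p.2) (C (onb H p.1))‖ ^ 2 := by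
    intro C hC
    refine (summable_prod_of_nonneg (fun _ => sq_nonneg _)).mpr
      ⟨fun i => (hasSum_onb_sq (C (onb H i))).summable, ?_⟩
    exact hC.congr (fun i => (hasSum_onb_sq (C (onb H i))).tsum_eq.symm)
  have e1 : ∀ i j, inner ℂ (A.adjoint (onb H i)) (onb H j) = inner ℂ (onb H i) (A (onb H j)) :=
    fun i j => ContinuousLinearMap.adjoint_inner_left _ _ _
  have e2 : ∀ i j, inner ℂ (B.adjoint (onb H j)) (onb H i) = inner ℂ (onb H j) (B (onb H i)) :=
    fun i j => ContinuousLinearMap.adjoint_inner_left _ _ _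
  -- Absolute convergence of the double series of matrix elements, by 2xy ≤ x² + y² and the two
  -- Hilbert–Schmidt norms. This justifies exchanging the sums.
  have hs : Summable fun p : onbSet H × onbSet H =>
      inner ℂ (onb H p.1) (A (onb H p.2)) * inner ℂ (onb H p.2) (B (onb H p.1)) := by
    refine Summable.of_norm_bounded ((h1 A hA).prod_symm.add (h1 B hB)) (fun p => ?_)
    rw [norm_mul]
    simp only [Prod.fst_swap, Prod.snd_swap]
    nlinarith [sq_nonneg (‖inner ℂ (onb H p.1) (A (onb H p.2))‖ -
      ‖inner ℂ (onb H p.2) (B (onb H p.1))‖),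
      sq_nonneg ‖inner ℂ (onb H p.1) (A (onb H p.2))‖,
      sq_nonneg ‖inner ℂ (onb H p.2) (B (onb H p.1))‖]
  have hs' : Summable (Function.uncurry fun i j : onbSet H =>
      inner ℂ (onb H i) (A (onb H j)) * inner ℂ (onb H j) (B (onb H i))) := hs
  calc _ = ∑' i, ∑' j, inner ℂ (onb H i) (A (onb H j)) * inner ℂ (onb H j) (B (onb H i)) := by
        refine tsum_congr (fun i => ?_)
        rw [← (onb H).tsum_inner_mul_inner]
        exact tsum_congr (fun j => by rw [e1])
    _ = ∑' j, ∑' i, inner ℂ (onb H i) (A (onb H j)) * inner ℂ (onb H j) (B (onb H i)) :=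
        hs'.tsum_comm.symm
    _ = _ := by
        refine tsum_congr (fun j => ?_)
        rw [← (onb H).tsum_inner_mul_inner]
        exact tsum_congr (fun i => by rw [e2, mul_comm])

/-- The images of the basis vectors under `√γ`; for positive trace class `γ` one has
`γ = ∑ |sqrtVec γ i⟩⟨sqrtVec γ i|`. -/
noncomputable def sqrtVec (γ : H →L[ℂ] H) (i : onbSet H) : H := CFC.sqrt γ (onb H i)

theorem sqrt_apply_sqrt {γ : H →L[ℂ] H} (h : 0 ≤ γ) (x : H) :
    CFC.sqrt γ (CFC.sqrt γ x) = γ x :=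
  congrArg (fun f : H →L[ℂ] H => f x) (CFC.sqrt_mul_sqrt_self γ h)

theorem inner_cfcSqrt (γ : H →L[ℂ] H) (x y : H) :
    inner ℂ (CFC.sqrt γ x) y = inner ℂ x (CFC.sqrt γ y) :=
  ((ContinuousLinearMap.nonneg_iff_isPositive _).mp (CFC.sqrt_nonneg γ)).1 x y

theorem summable_sqrtVec {γ : H →L[ℂ] H} (hγ : γ ∈ positiveTraceClass H) :
    Summable fun i => ‖sqrtVec γ i‖ ^ 2 := by
  refine ((isTraceClass_iff_of_nonneg hγ.1).mp hγ.2).congr (fun i => ?_)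
  rw [← sqrt_apply_sqrt hγ.1, ← inner_cfcSqrt]
  exact inner_self_eq_norm_sq (𝕜 := ℂ) _

/-- Cyclicity for the Hilbert–Schmidt operators B√γ and √γ. It turns a trace against γ into a series
of quadratic form values, which are nonnegative when B is. -/
theorem hasSum_opTrace_mul {γ : H →L[ℂ] H} (hγ : γ ∈ positiveTraceClass H) (B : H →L[ℂ] H) :
    HasSum (fun i => inner ℂ (sqrtVec γ i) (B (sqrtVec γ i))) (opTrace (B * γ)) := by
  have h1 := summable_sqrtVec hγ
  have h2 : Summable fun i => ‖(B * CFC.sqrt γ) (onb H i)‖ ^ 2 := by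
    refine Summable.of_nonneg_of_le (fun _ => by positivity) (fun i => ?_) (h1.mul_left (‖B‖ ^ 2))
    rw [← mul_pow]
    gcongr
    exact B.le_opNorm _
  have h3 : Summable fun i => inner ℂ (sqrtVec γ i) (B (sqrtVec γ i)) := by
    refine Summable.of_norm_bounded (h1.mul_left ‖B‖) (fun i => ?_)
    refine (norm_inner_le_norm _ _).trans ?_
    have := B.le_opNorm (sqrtVec γ i)
    nlinarith [norm_nonneg (sqrtVec γ i)]
  convert h3.hasSum using 1
  have e := tsum_inner_adjoint_comm (B * CFC.sqrt γ) (CFC.sqrt γ) h2 h1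
  rw [opTrace]
  refine Eq.trans (tsum_congr (fun i => ?_)) (e.trans (tsum_congr (fun i => ?_)))
  · rw [ContinuousLinearMap.adjoint_inner_left]
    change inner ℂ _ (B (γ _)) = inner ℂ _ (B (CFC.sqrt γ (CFC.sqrt γ _)))
    rw [sqrt_apply_sqrt hγ.1]
  · rw [ContinuousLinearMap.adjoint_inner_left, ← inner_cfcSqrt]
    rfl

theorem hasSum_re_opTrace_mul {γ : H →L[ℂ] H} (hγ : γ ∈ positiveTraceClass H) (B : H →L[ℂ] H) :
    HasSum (fun i => (inner ℂ (sqrtVec γ i) (B (sqrtVec γ i))).re) (opTrace (B * γ)).re :=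
  Complex.hasSum_re (hasSum_opTrace_mul hγ B)

theorem hasSum_re_opTrace {γ : H →L[ℂ] H} (hγ : γ ∈ positiveTraceClass H) :
    HasSum (fun i => ‖sqrtVec γ i‖ ^ 2) (opTrace γ).re := by
  have h := hasSum_re_opTrace_mul hγ 1
  rw [one_mul] at h
  convert h using 1
  funext i
  exact (inner_self_eq_norm_sq (𝕜 := ℂ) _).symm

/-! ### Rank-one operators -/

theorem hasSum_mul_rankOne (B : H →L[ℂ] H) (ψ : H) :
    HasSum (fun i => inner ℂ (onb H i) ((B * InnerProductSpace.rankOne ℂ ψ ψ) (onb H i)))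
      (inner ℂ ψ (B ψ)) := by
  refine ((onb H).hasSum_inner_mul_inner ψ (B ψ)).congr_fun (fun i => ?_)
  change inner ℂ _ (B (InnerProductSpace.rankOne ℂ ψ ψ _)) = _
  rw [InnerProductSpace.rankOne_apply, map_smul, inner_smul_right]

theorem opTrace_mul_rankOne (B : H →L[ℂ] H) (ψ : H) :
    opTrace (B * InnerProductSpace.rankOne ℂ ψ ψ) = inner ℂ ψ (B ψ) :=
  (hasSum_mul_rankOne B ψ).tsum_eq

theorem rankOne_mem_positiveTraceClass (ψ : H) :
    InnerProductSpace.rankOne ℂ ψ ψ ∈ positiveTraceClass H := by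
  have h0 : 0 ≤ InnerProductSpace.rankOne ℂ ψ ψ :=
    (ContinuousLinearMap.nonneg_iff_isPositive _).mpr (InnerProductSpace.isPositive_rankOne_self ψ)
  refine ⟨h0, (isTraceClass_iff_of_nonneg h0).mpr ?_⟩
  have := (Complex.hasSum_re (hasSum_mul_rankOne 1 ψ)).summable
  simpa only [one_mul] using this

end

namespace PosOp

section

variable {H : Type*} [NormedAddCommGroup H] [InnerProductSpace ℂ H] [CompleteSpace H]
variable (V T : PosOp H)

/-! ### The trace `Tr (V γ)` -/

theorem ofReal_opTrace_le (ε : Set.Ioi (0 : ℝ)) (γ : H →L[ℂ] H) :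
    ENNReal.ofReal (opTrace (V.yosida ε * γ)).re ≤ V.traceMul γ :=
  le_iSup (fun ε => ENNReal.ofReal (opTrace (V.yosida ε * γ)).re) ε

theorem re_opTrace_le {γ : H →L[ℂ] H} (hγ : γ ∈ V.XPlus) (ε : Set.Ioi (0 : ℝ)) :
    (opTrace (V.yosida ε * γ)).re ≤ (V.traceMul γ).toReal :=
  (ENNReal.ofReal_le_iff_le_toReal hγ.2.ne).mp (V.ofReal_opTrace_le ε γ)

/-- A single term of a nonnegative series is at most its sum, which is at most Tr(Vγ) for every ε.
-/
theorem sqrtVec_mem {γ : H →L[ℂ] H} (hγ : γ ∈ V.XPlus) (i : onbSet H) :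
    sqrtVec γ i ∈ V.formDomain := by
  refine V.mem_formDomain_of_le _ (V.traceMul γ).toReal (fun n => ?_)
  exact (le_hasSum (hasSum_re_opTrace_mul hγ.1 (V.yosida (eps n))) i
    (fun j _ => V.re_inner_yosida_nonneg _ _)).trans (V.re_opTrace_le hγ _)

/-- The vectors `sqrtVec γ i` as elements of the form domain. -/
noncomputable def formVec {γ : H →L[ℂ] H} (hγ : γ ∈ V.XPlus) (i : onbSet H) : V.formDomain :=
  ⟨sqrtVec γ i, V.sqrtVec_mem hγ i⟩

theorem re_inner_yosida_le (ε : Set.Ioi (0 : ℝ)) (ψ : V.formDomain) :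
    (inner ℂ (ψ : H) (V.yosida ε ψ)).re ≤ ‖V.sqrtForm ψ‖ ^ 2 :=
  (Complex.re_le_norm _).trans (V.norm_inner_yosida_le ε ψ)

theorem tendsto_re_inner_yosida (ψ : V.formDomain) :
    Tendsto (fun n => (inner ℂ (ψ : H) (V.yosida (eps n) ψ)).re) atTop
      (𝓝 (‖V.sqrtForm ψ‖ ^ 2)) :=
  (Complex.continuous_re.tendsto _).comp (V.tendsto_inner_yosida ψ)

theorem summable_formVec {γ : H →L[ℂ] H} (hγ : γ ∈ V.XPlus) :
    Summable fun i => ‖V.sqrtForm (V.formVec hγ i)‖ ^ 2 := by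
  refine summable_of_sum_le (c := (V.traceMul γ).toReal) (fun _ => sq_nonneg _) (fun s => ?_)
  refine le_of_tendsto' (tendsto_finsetSum s
    (fun i _ => V.tendsto_re_inner_yosida (V.formVec hγ i))) (fun n => ?_)
  exact (sum_le_hasSum s (fun j _ => V.re_inner_yosida_nonneg _ _)
    (hasSum_re_opTrace_mul hγ.1 (V.yosida (eps n)))).trans (V.re_opTrace_le hγ _)

theorem mem_XPlus_of_summable {γ : H →L[ℂ] H} (hγ : γ ∈ positiveTraceClass H)
    (h : ∀ i, sqrtVec γ i ∈ V.formDomain)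
    (hs : Summable fun i => ‖V.sqrtForm ⟨sqrtVec γ i, h i⟩‖ ^ 2) : γ ∈ V.XPlus := by
  refine ⟨hγ, lt_of_le_of_lt (iSup_le (fun ε => ?_)) (ENNReal.ofReal_lt_top
    (r := ∑' i, ‖V.sqrtForm ⟨sqrtVec γ i, h i⟩‖ ^ 2))⟩
  exact ENNReal.ofReal_le_ofReal (hasSum_le (fun i => V.re_inner_yosida_le ε ⟨_, h i⟩)
    (hasSum_re_opTrace_mul hγ (V.yosida ε)) hs.hasSum)

theorem tendsto_opTrace_yosida_aux {γ : H →L[ℂ] H} (hγ : γ ∈ V.XPlus) :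
    Tendsto (fun n => (opTrace (V.yosida (eps n) * γ)).re) atTop
      (𝓝 (∑' i, ‖V.sqrtForm (V.formVec hγ i)‖ ^ 2)) := by
  simp only [← (hasSum_re_opTrace_mul hγ.1 _).tsum_eq]
  refine tendsto_tsum_of_dominated_convergence (V.summable_formVec hγ)
    (fun i => V.tendsto_re_inner_yosida (V.formVec hγ i))
    (Eventually.of_forall (fun n i => ?_))
  rw [Real.norm_of_nonneg (V.re_inner_yosida_nonneg _ _)]
  exact V.re_inner_yosida_le _ (V.formVec hγ i)

/-- Every regularized trace is at most the series, and by dominated convergence the regularized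
traces tend to the series along ε = 1/(n+1). The supremum defining Tr(Vγ) is therefore a limit, and
so additive in γ. -/
theorem tsum_formVec {γ : H →L[ℂ] H} (hγ : γ ∈ V.XPlus) :
    ∑' i, ‖V.sqrtForm (V.formVec hγ i)‖ ^ 2 = (V.traceMul γ).toReal := by
  refine le_antisymm (le_of_tendsto' (V.tendsto_opTrace_yosida_aux hγ)
    (fun n => V.re_opTrace_le hγ _)) ?_
  refine ENNReal.toReal_le_of_le_ofReal (tsum_nonneg (fun _ => sq_nonneg _))
    (iSup_le (fun ε => ENNReal.ofReal_le_ofReal ?_))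
  exact hasSum_le (fun i => V.re_inner_yosida_le ε (V.formVec hγ i))
    (hasSum_re_opTrace_mul hγ.1 (V.yosida ε)) (V.summable_formVec hγ).hasSum

theorem hasSum_traceMul {γ : H →L[ℂ] H} (hγ : γ ∈ V.XPlus) :
    HasSum (fun i => ‖V.sqrtForm (V.formVec hγ i)‖ ^ 2) (V.traceMul γ).toReal := by
  rw [← V.tsum_formVec hγ]
  exact (V.summable_formVec hγ).hasSum

theorem tendsto_opTrace_yosida {γ : H →L[ℂ] H} (hγ : γ ∈ V.XPlus) :
    Tendsto (fun n => (opTrace (V.yosida (eps n) * γ)).re) atTop (𝓝 (V.traceMul γ).toReal) := by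
  rw [← V.tsum_formVec hγ]
  exact V.tendsto_opTrace_yosida_aux hγ

theorem rankOne_mem_XPlus (ψ : V.formDomain) :
    InnerProductSpace.rankOne ℂ (ψ : H) (ψ : H) ∈ V.XPlus := by
  refine ⟨rankOne_mem_positiveTraceClass _, lt_of_le_of_lt (iSup_le (fun ε => ?_))
    (ENNReal.ofReal_lt_top (r := ‖V.sqrtForm ψ‖ ^ 2))⟩
  rw [opTrace_mul_rankOne]
  exact ENNReal.ofReal_le_ofReal (V.re_inner_yosida_le ε ψ)

theorem traceMul_rankOne (ψ : V.formDomain) :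
    (V.traceMul (InnerProductSpace.rankOne ℂ (ψ : H) (ψ : H))).toReal = ‖V.sqrtForm ψ‖ ^ 2 := by
  refine tendsto_nhds_unique (V.tendsto_opTrace_yosida (V.rankOne_mem_XPlus ψ)) ?_
  simp only [opTrace_mul_rankOne]
  exact V.tendsto_re_inner_yosida ψ

/-! ### The space `X` -/

theorem mem_X_of_mem_XPlus {γ : H →L[ℂ] H} (hγ : γ ∈ T.XPlus) : γ ∈ T.X :=
  ⟨γ, hγ, 0, T.XPlus_zero, (sub_zero γ).symm⟩

theorem rankOne_mem_X (ψ : T.formDomain) :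
    InnerProductSpace.rankOne ℂ (ψ : H) (ψ : H) ∈ T.X :=
  T.mem_X_of_mem_XPlus (T.rankOne_mem_XPlus ψ)

theorem summable_trace_mul_X (B : H →L[ℂ] H) (γ : T.X) :
    Summable fun i => inner ℂ (onb H i) ((B * (γ : H →L[ℂ] H)) (onb H i)) := by
  obtain ⟨_, a, ha, b, hb, rfl⟩ := γ
  refine ((summable_trace_mul B ha.1).sub (summable_trace_mul B hb.1)).congr (fun i => ?_)
  rw [mul_sub, sub_apply, inner_sub_right]

/-- The linear functional `γ ↦ Re Tr (B γ)` on `X`, for a bounded operator `B`. -/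
noncomputable def traceFunctional (B : H →L[ℂ] H) : T.X →ₗ[ℝ] ℝ where
  toFun γ := (opTrace (B * (γ : H →L[ℂ] H))).re
  map_add' γ δ := by
    rw [← Complex.add_re, opTrace, opTrace, opTrace,
      ← (T.summable_trace_mul_X B γ).tsum_add (T.summable_trace_mul_X B δ)]
    congr 1
    refine tsum_congr (fun i => ?_)
    rw [Submodule.coe_add, mul_add, add_apply, inner_add_right]
  map_smul' c γ := by
    rw [RingHom.id_apply, smul_eq_mul, ← Complex.re_ofReal_mul, opTrace, opTrace, ← tsum_mul_left]
    congr 1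
    refine tsum_congr (fun i => ?_)
    rw [Submodule.coe_smul, mul_smul_comm, smul_apply, ← Complex.coe_smul, inner_smul_right]

theorem traceFunctional_apply (B : H →L[ℂ] H) (γ : T.X) :
    T.traceFunctional B γ = (opTrace (B * (γ : H →L[ℂ] H))).re := rfl

/-- `γ ↦ Tr (V γ)` extends to a linear functional on `X`. -/
theorem exists_linear_traceMul (h : T.XPlus ⊆ V.XPlus) :
    ∃ τ : T.X →ₗ[ℝ] ℝ, ∀ (γ : T.X), (γ : H →L[ℂ] H) ∈ T.XPlus →
      τ γ = (V.traceMul (γ : H →L[ℂ] H)).toReal := by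
  -- Convergence on X⁺ passes to differences, and a pointwise limit of linear functionals is linear;
  -- no choice of decomposition enters.
  have h1 : ∀ γ : T.X, ∃ r : ℝ,
      Tendsto (fun n => T.traceFunctional (V.yosida (eps n)) γ) atTop (𝓝 r) := by
    intro γ
    obtain ⟨a, ha, b, hb, e⟩ := γ.2
    have e' : γ = (⟨a, T.mem_X_of_mem_XPlus ha⟩ : T.X) - ⟨b, T.mem_X_of_mem_XPlus hb⟩ :=
      Subtype.ext e
    refine ⟨(V.traceMul a).toReal - (V.traceMul b).toReal, ?_⟩
    rw [e']
    simp only [map_sub]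
    exact (V.tendsto_opTrace_yosida (h ha)).sub (V.tendsto_opTrace_yosida (h hb))
  choose f hf using h1
  refine ⟨linearMapOfTendsto f (fun n => T.traceFunctional (V.yosida (eps n))) (l := atTop)
    (tendsto_pi_nhds.mpr hf), fun γ hγ => ?_⟩
  exact tendsto_nhds_unique (hf γ) (V.tendsto_opTrace_yosida (h hγ))

/-! ### The norm of `X` -/

theorem oneAdd_form (ψ : T.formDomain) : ∃ h : (ψ : H) ∈ T.oneAdd.formDomain,
    ‖T.oneAdd.sqrtForm ⟨ψ, h⟩‖ ^ 2 = T.normSqT ψ := by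
  obtain ⟨h, h'⟩ := T.form_of_shift_aux (W := T.oneAdd) 1 le_rfl
    (fun x => (LinearPMap.vadd_apply _ _ _).trans (add_comm _ _)) ψ
  exact ⟨h, by rw [h', normSqT_eq]; ring⟩

theorem formDomain_oneAdd : T.oneAdd.formDomain = T.formDomain :=
  T.formDomain_eq_of_shift 1 rfl
    (fun _ => (LinearPMap.vadd_apply _ _ _).trans (add_comm _ _))

theorem summable_normSqT {γ : H →L[ℂ] H} (hγ : γ ∈ T.XPlus) :
    HasSum (fun i => T.normSqT (T.formVec hγ i)) ((opTrace γ).re + (T.traceMul γ).toReal) :=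
  (hasSum_re_opTrace hγ.1).add (T.hasSum_traceMul hγ)

/-- The forms of 1+T and T differ by ‖ψ‖², which is summable along √γ e_i. Hence the decompositions
of finite cost in the norm of X are exactly those with both parts in X⁺. -/
theorem XPlus_oneAdd : T.oneAdd.XPlus = T.XPlus := by
  ext γ
  constructor
  · intro hγ
    have hm : ∀ i, sqrtVec γ i ∈ T.formDomain := fun i =>
      T.formDomain_oneAdd.le (T.oneAdd.sqrtVec_mem hγ i)
    refine T.mem_XPlus_of_summable hγ.1 hm ?_
    refine Summable.of_nonneg_of_le (fun _ => sq_nonneg _) (fun i => ?_)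
      (T.oneAdd.summable_formVec hγ)
    have h := (T.oneAdd_form ⟨_, hm i⟩).choose_spec
    refine le_trans ?_ h.ge
    rw [normSqT_eq]
    exact le_add_of_nonneg_left (sq_nonneg _)
  · intro hγ
    refine T.oneAdd.mem_XPlus_of_summable hγ.1 (fun i => (T.oneAdd_form (T.formVec hγ i)).choose) ?_
    exact (T.summable_normSqT hγ).summable.congr
      (fun i => ((T.oneAdd_form (T.formVec hγ i)).choose_spec).symm)

theorem hasSum_normSqT {γ : H →L[ℂ] H} (hγ : γ ∈ T.XPlus) :
    HasSum (fun i => T.normSqT (T.formVec hγ i)) (T.oneAdd.traceMul γ).toReal :=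
  (T.oneAdd.hasSum_traceMul (T.XPlus_oneAdd.ge hγ)).congr_fun
    (fun i => ((T.oneAdd_form (T.formVec hγ i)).choose_spec).symm)

theorem normX_le (γ : T.X) {a b : H →L[ℂ] H} (ha : a ∈ T.XPlus) (hb : b ∈ T.XPlus)
    (h : (γ : H →L[ℂ] H) = a - b) :
    T.normX γ ≤ (T.oneAdd.traceMul a).toReal + (T.oneAdd.traceMul b).toReal := by
  have ha' := (T.XPlus_oneAdd.ge ha).2.ne
  have hb' := (T.XPlus_oneAdd.ge hb).2.ne
  rw [← ENNReal.toReal_add ha' hb']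
  refine ENNReal.toReal_mono (ENNReal.add_ne_top.mpr ⟨ha', hb'⟩) ?_
  exact iInf₂_le_of_le a ha.1 (iInf₂_le_of_le b hb.1 (iInf_le _ h))

theorem normX_le_of_mem_XPlus (γ : T.X) (h : (γ : H →L[ℂ] H) ∈ T.XPlus) :
    T.normX γ ≤ (T.oneAdd.traceMul (γ : H →L[ℂ] H)).toReal := by
  have h0 : (T.oneAdd.traceMul (0 : H →L[ℂ] H)).toReal = 0 := by simp [traceMul, opTrace]
  have := T.normX_le γ h T.XPlus_zero (sub_zero _).symm
  rwa [h0, add_zero] at this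

theorem normX_rankOne_le (ψ : T.formDomain) :
    T.normX ⟨_, T.rankOne_mem_X ψ⟩ ≤ T.normSqT ψ := by
  refine (T.normX_le_of_mem_XPlus _ (T.rankOne_mem_XPlus ψ)).trans (le_of_eq ?_)
  obtain ⟨h, h'⟩ := T.oneAdd_form ψ
  rw [← h']
  exact T.oneAdd.traceMul_rankOne ⟨ψ, h⟩

/-- Decompositions with a part outside X⁺ cost ⊤ and do not affect the infimum. The case K = 0 is
separate because the proof divides by K; there any one decomposition suffices. -/
theorem le_mul_normX (γ : T.X) {r K : ℝ} (hK : 0 ≤ K)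
    (h : ∀ a ∈ T.XPlus, ∀ b ∈ T.XPlus, (γ : H →L[ℂ] H) = a - b →
      r ≤ K * ((T.oneAdd.traceMul a).toReal + (T.oneAdd.traceMul b).toReal)) :
    r ≤ K * T.normX γ := by
  obtain ⟨a, ha, b, hb, e⟩ := γ.2
  rcases hK.eq_or_lt with rfl | hK
  · have := h a ha b hb e
    rwa [zero_mul] at this ⊢
  have hne : T.extNormX (γ : H →L[ℂ] H) ≠ ⊤ := by
    refine ne_top_of_le_ne_top (ENNReal.add_ne_top.mpr
      ⟨(T.XPlus_oneAdd.ge ha).2.ne, (T.XPlus_oneAdd.ge hb).2.ne⟩) ?_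
    exact iInf₂_le_of_le a ha.1 (iInf₂_le_of_le b hb.1 (iInf_le _ e))
  rw [← div_le_iff₀' hK, normX, ← ENNReal.ofReal_le_iff_le_toReal hne]
  refine le_iInf₂ (fun c hc => le_iInf₂ (fun d hd => le_iInf (fun e' => ?_)))
  by_cases ht : T.oneAdd.traceMul c + T.oneAdd.traceMul d = ⊤
  · rw [ht]; exact le_top
  · obtain ⟨h1, h2⟩ := ENNReal.add_ne_top.mp ht
    rw [ENNReal.ofReal_le_iff_le_toReal ht, ENNReal.toReal_add h1 h2, div_le_iff₀' hK]
    exact h c (T.XPlus_oneAdd.le ⟨hc, h1.lt_top⟩) d (T.XPlus_oneAdd.le ⟨hd, h2.lt_top⟩) e'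

/-! ### Finite rank approximation in `X` -/

/-- The quadratic form of the remainder at x is ‖√γ x‖² - ∑_{i ∈ s} |⟨e_i, √γ x⟩|², nonnegative by
Bessel's inequality. Its regularized traces arise from those of γ by removing nonnegative terms. -/
theorem sub_sum_rankOne_mem_XPlus {γ : H →L[ℂ] H} (hγ : γ ∈ T.XPlus) (s : Finset (onbSet H)) :
    γ - ∑ i ∈ s, InnerProductSpace.rankOne ℂ (sqrtVec γ i) (sqrtVec γ i) ∈ T.XPlus := by
  set ρ := γ - ∑ i ∈ s, InnerProductSpace.rankOne ℂ (sqrtVec γ i) (sqrtVec γ i) with hρ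
  have hin : ∀ x y, inner ℂ x (ρ y) = inner ℂ (CFC.sqrt γ x) (CFC.sqrt γ y) -
      ∑ i ∈ s, inner ℂ (CFC.sqrt γ x) (onb H i) * inner ℂ (onb H i) (CFC.sqrt γ y) := by
    intro x y
    rw [hρ, sub_apply, sum_apply, inner_sub_right, inner_sum, inner_cfcSqrt,
      sqrt_apply_sqrt hγ.1.1]
    congr 1
    refine Finset.sum_congr rfl (fun i _ => ?_)
    rw [InnerProductSpace.rankOne_apply, inner_smul_right, sqrtVec, ← inner_cfcSqrt,
      inner_cfcSqrt, inner_cfcSqrt]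
    rw [mul_comm]
  have hself : ∀ x, (inner ℂ x (ρ x)).re = ‖CFC.sqrt γ x‖ ^ 2 -
      ∑ i ∈ s, ‖inner ℂ (onb H i) (CFC.sqrt γ x)‖ ^ 2 := by
    intro x
    rw [hin, Complex.sub_re, Complex.re_sum]
    congr 1
    · exact inner_self_eq_norm_sq (𝕜 := ℂ) _
    · refine Finset.sum_congr rfl (fun i _ => ?_)
      rw [← inner_conj_symm (CFC.sqrt γ x), ← Complex.normSq_eq_conj_mul_self, Complex.ofReal_re,
        Complex.normSq_eq_norm_sq]
  have hpos : 0 ≤ ρ := by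
    rw [ContinuousLinearMap.nonneg_iff_isPositive]
    have hsymm : ∀ x y, inner ℂ (ρ x) y = inner ℂ x (ρ y) := by
      intro x y
      rw [← inner_conj_symm, hin, hin, map_sub, map_sum, inner_conj_symm]
      congr 1
      refine Finset.sum_congr rfl (fun i _ => ?_)
      rw [map_mul, inner_conj_symm, inner_conj_symm, mul_comm]
    refine ⟨hsymm, fun x => ?_⟩
    rw [ContinuousLinearMap.reApplyInnerSelf_apply, hsymm]
    change 0 ≤ (inner ℂ x (ρ x)).re
    rw [hself]
    exact sub_nonneg.mpr (sum_le_hasSum s (fun _ _ => sq_nonneg _) (hasSum_onb_sq _))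
  have hB : ∀ B : H →L[ℂ] H, HasSum (fun i => inner ℂ (onb H i) ((B * ρ) (onb H i)))
      (opTrace (B * γ) - ∑ i ∈ s, inner ℂ (sqrtVec γ i) (B (sqrtVec γ i))) := by
    intro B
    refine ((summable_trace_mul B hγ.1).hasSum.sub
      (hasSum_sum (fun i (_ : i ∈ s) => hasSum_mul_rankOne B (sqrtVec γ i)))).congr_fun
      (fun j => ?_)
    rw [hρ, mul_sub, sub_apply, inner_sub_right, Finset.mul_sum, sum_apply, inner_sum]
  refine ⟨⟨hpos, (isTraceClass_iff_of_nonneg hpos).mpr ?_⟩, lt_of_le_of_lt ?_ hγ.2⟩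
  · simpa only [one_mul] using (Complex.hasSum_re (hB 1)).summable
  · refine iSup_mono (fun ε => ENNReal.ofReal_le_ofReal ?_)
    rw [opTrace, (hB _).tsum_eq, Complex.sub_re, Complex.re_sum]
    exact sub_le_self _ (Finset.sum_nonneg (fun i _ => T.re_inner_yosida_nonneg _ _))

/-- A bounded functional on `X` is determined by its values on rank-one operators. -/
theorem hasSum_dualX (ω : T.X →ₗ[ℝ] ℝ) (hω : ω ∈ T.dualX) {γ : H →L[ℂ] H} (hγ : γ ∈ T.XPlus) :
    HasSum (fun i => ω ⟨_, T.rankOne_mem_X (T.formVec hγ i)⟩) (ω ⟨γ, T.mem_X_of_mem_XPlus hγ⟩) := by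
  obtain ⟨C, hC, h⟩ := hω
  -- The linear extension of γ ↦ Tr((1+T)γ). Its value at a remainder is a tail of ∑ ‖s_i‖_T² and
  -- bounds the X-norm of that remainder.
  obtain ⟨τ, hτ⟩ := T.oneAdd.exists_linear_traceMul T T.XPlus_oneAdd.ge
  have hτ1 : ∀ i, τ ⟨_, T.rankOne_mem_X (T.formVec hγ i)⟩ = T.normSqT (T.formVec hγ i) := by
    intro i
    rw [hτ _ (T.rankOne_mem_XPlus _)]
    obtain ⟨h, h'⟩ := T.oneAdd_form (T.formVec hγ i)
    rw [← h']
    exact T.oneAdd.traceMul_rankOne ⟨_, h⟩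
  have hs := T.hasSum_normSqT hγ
  set γ' : T.X := ⟨γ, T.mem_X_of_mem_XPlus hγ⟩ with hγ'
  have hb : ∀ s : Finset (onbSet H),
      |(∑ i ∈ s, ω ⟨_, T.rankOne_mem_X (T.formVec hγ i)⟩) - ω γ'| ≤
        C * ((T.oneAdd.traceMul γ).toReal - ∑ i ∈ s, T.normSqT (T.formVec hγ i)) := by
    intro s
    set ρ : T.X := γ' - ∑ i ∈ s, ⟨_, T.rankOne_mem_X (T.formVec hγ i)⟩ with hρ
    have hρX : (ρ : H →L[ℂ] H) ∈ T.XPlus := by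
      have := T.sub_sum_rankOne_mem_XPlus hγ s
      rw [hρ, Submodule.coe_sub, Submodule.coe_sum]
      exact this
    have e1 : ω ρ = ω γ' - ∑ i ∈ s, ω ⟨_, T.rankOne_mem_X (T.formVec hγ i)⟩ := by
      rw [hρ, map_sub, map_sum]
    have e2 : τ ρ = (T.oneAdd.traceMul γ).toReal - ∑ i ∈ s, T.normSqT (T.formVec hγ i) := by
      rw [hρ, map_sub, map_sum, hτ γ' hγ]
      simp only [hτ1]
      rfl
    rw [abs_sub_comm, ← e1, ← e2, hτ ρ hρX]
    exact (h ρ).trans (mul_le_mul_of_nonneg_left (T.normX_le_of_mem_XPlus ρ hρX) hC.le)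
  have ht : Tendsto (fun s : Finset (onbSet H) =>
      C * ((T.oneAdd.traceMul γ).toReal - ∑ i ∈ s, T.normSqT (T.formVec hγ i))) atTop (𝓝 0) := by
    have : Tendsto (fun s : Finset (onbSet H) => ∑ i ∈ s, T.normSqT (T.formVec hγ i)) atTop
      (𝓝 (T.oneAdd.traceMul γ).toReal) := hs
    simpa using (this.const_sub (T.oneAdd.traceMul γ).toReal).const_mul C
  refine tendsto_iff_norm_sub_tendsto_zero.mpr ?_
  exact squeeze_zero (fun _ => norm_nonneg _) hb ht

end

end PosOp

/-! ### Polarization, bounded forms and coercive operators -/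

section

variable {E : Type*} [AddCommGroup E] [Module ℂ E]

/-- The polarization identity. -/
theorem sesq_polarization (w : E →ₗ⋆[ℂ] E →ₗ[ℂ] ℂ) (x y : E) :
    w x y = 1 / 4 * ∑ k ∈ Finset.range 4, Complex.I ^ k *
      w (x + (-Complex.I) ^ k • y) (x + (-Complex.I) ^ k • y) := by
  have h2 : Complex.I ^ 2 = -1 := Complex.I_sq
  have h3 : Complex.I ^ 3 = -Complex.I := Complex.I_pow_three
  have h4 : (-Complex.I) ^ 2 = -1 := by rw [neg_sq, h2]
  have h5 : (-Complex.I) ^ 3 = Complex.I := by rw [neg_pow, h3]; ring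
  simp only [Finset.sum_range_succ, Finset.sum_range_zero, pow_zero, pow_one, h2, h3, h4, h5,
    map_add, LinearMap.add_apply, map_smul, LinearMap.map_smulₛₗ, LinearMap.smul_apply,
    smul_eq_mul, map_neg, Complex.conj_I, map_one]
  linear_combination (1 / 2 * w x y - 1 / 2 * w y x) * h2

end

section

variable {H : Type*} [NormedAddCommGroup H] [InnerProductSpace ℂ H] [CompleteSpace H]

/-- A bounded sesquilinear form is represented by a bounded operator. -/
theorem exists_operator_of_bounded_form (w : H →ₗ⋆[ℂ] H →ₗ[ℂ] ℂ)
    (C : ℝ) (hC : ∀ x, ‖w x x‖ ≤ C * ‖x‖ ^ 2) :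
    ∃ B : H →L[ℂ] H, ∀ x y, inner ℂ (B x) y = w x y := by
  -- Polarization bounds w(x,y) by diagonal values, and the parallelogram law sums the four squared
  -- norms to 4(‖x‖² + ‖y‖²). On unit vectors this gives 2C, the constant in `h2` below.
  have h1 : ∀ x y, ‖w x y‖ ≤ C * (‖x‖ ^ 2 + ‖y‖ ^ 2) := by
    intro x y
    have h2 : ∀ k, ‖Complex.I ^ k * w (x + (-Complex.I) ^ k • y) (x + (-Complex.I) ^ k • y)‖ ≤
        C * ‖x + (-Complex.I) ^ k • y‖ ^ 2 := by
      intro k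
      rw [norm_mul, norm_pow, Complex.norm_I, one_pow, one_mul]
      exact hC _
    have h3 : ∑ k ∈ Finset.range 4, ‖x + (-Complex.I) ^ k • y‖ ^ 2 =
        4 * (‖x‖ ^ 2 + ‖y‖ ^ 2) := by
      have h4 : ∀ z : H, ‖x + z‖ ^ 2 + ‖x - z‖ ^ 2 = 2 * (‖x‖ ^ 2 + ‖z‖ ^ 2) := by
        intro z
        have := parallelogram_law_with_norm ℂ x z
        nlinarith
      have h5 := h4 y
      have h6 := h4 (Complex.I • y)
      rw [norm_smul, Complex.norm_I, one_mul] at h6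
      have h7 : (-Complex.I) ^ 2 = -1 := by rw [neg_sq, Complex.I_sq]
      have h8 : (-Complex.I) ^ 3 = Complex.I := by rw [neg_pow, Complex.I_pow_three]; ring
      simp only [Finset.sum_range_succ, Finset.sum_range_zero, pow_zero, pow_one, h7, h8, neg_smul,
        one_smul, ← sub_eq_add_neg]
      linarith
    rw [sesq_polarization, norm_mul]
    have h9 := (norm_sum_le (Finset.range 4) (fun k => Complex.I ^ k *
      w (x + (-Complex.I) ^ k • y) (x + (-Complex.I) ^ k • y))).trans
      (Finset.sum_le_sum (fun k _ => h2 k))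
    rw [← Finset.mul_sum, h3] at h9
    have h10 : ‖(1 / 4 : ℂ)‖ = 1 / 4 := by norm_num
    rw [h10]
    linarith
  have h2 : ∀ x y, ‖w x y‖ ≤ 2 * C * ‖x‖ * ‖y‖ := by
    intro x y
    rcases eq_or_ne x 0 with rfl | hx
    · simp
    rcases eq_or_ne y 0 with rfl | hy
    · simp
    have hx' : 0 < ‖x‖ := norm_pos_iff.mpr hx
    have hy' : 0 < ‖y‖ := norm_pos_iff.mpr hy
    have h3 := h1 (((‖x‖⁻¹ : ℝ) : ℂ) • x) (((‖y‖⁻¹ : ℝ) : ℂ) • y)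
    rw [map_smul, LinearMap.map_smulₛₗ, LinearMap.smul_apply, norm_smul, norm_smul, norm_smul,
      norm_smul, Complex.conj_ofReal, Complex.norm_real, Complex.norm_real, norm_inv, norm_inv,
      norm_norm, norm_norm, inv_mul_cancel₀ hx'.ne', inv_mul_cancel₀ hy'.ne'] at h3
    rw [← mul_assoc, ← mul_inv, inv_mul_le_iff₀ (by positivity)] at h3
    linarith
  refine ⟨InnerProductSpace.continuousLinearMapOfBilin (LinearMap.mkContinuous₂ w (2 * C) h2),
    fun x y => ?_⟩
  rw [InnerProductSpace.continuousLinearMapOfBilin_apply, LinearMap.mkContinuous₂_apply]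

/-- A coercive symmetric bounded operator is invertible. -/
theorem isUnit_of_coercive (B : H →L[ℂ] H) (hs : ∀ x y, inner ℂ (B x) y = inner ℂ x (B y))
    (c : ℝ) (hc : 0 < c) (h : ∀ x, c * ‖x‖ ^ 2 ≤ (inner ℂ (B x) x).re) : IsUnit B := by
  have h1 : ((c : ℂ) • (1 : H →L[ℂ] H)) ≤ B := by
    rw [ContinuousLinearMap.le_def]
    refine ⟨fun x y => ?_, fun x => ?_⟩
    · simp only [ContinuousLinearMap.coe_coe, sub_apply, smul_apply, one_apply_eq_self,
        inner_sub_left, inner_sub_right, inner_smul_left, inner_smul_right, Complex.conj_ofReal, hs]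
    · rw [ContinuousLinearMap.reApplyInnerSelf_apply, sub_apply, inner_sub_left, map_sub,
        smul_apply, one_apply_eq_self, inner_smul_left, Complex.conj_ofReal]
      have e : (inner ℂ x x).re = ‖x‖ ^ 2 := inner_self_eq_norm_sq (𝕜 := ℂ) _
      have := h x
      simp only [RCLike.re_to_complex, Complex.re_ofReal_mul, e]
      linarith
  have h2 : IsStrictlyPositive ((c : ℂ) • (1 : H →L[ℂ] H)) := by
    rw [Complex.coe_smul]
    exact IsStrictlyPositive.smul hc isStrictlyPositive_one
  exact CStarAlgebra.isUnit_of_le _ h1 h2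

end

namespace PosOp

section

variable {H : Type*} [NormedAddCommGroup H] [InnerProductSpace ℂ H] [CompleteSpace H]
variable (T : PosOp H)

/-! ### Operators associated with forms -/

theorem ext_toPMap {A B : PosOp H} (h : A.toPMap = B.toPMap) : A = B := by
  cases A; cases B; congr

/-- The inverse of an injective bounded positive operator, as an unbounded positive operator. -/
noncomputable def ofInverse (M : H →L[ℂ] H) (hM : 0 ≤ M) (hi : Function.Injective M) :
    PosOp H where
  toPMap :=
    { domain := LinearMap.range M.toLinearMap
      toFun := (LinearEquiv.ofInjective M.toLinearMap hi).symm.toLinearMap }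
  isSelfAdjoint := by
    have hs : ∀ x y, inner ℂ (M x) y = inner ℂ x (M y) :=
      ((ContinuousLinearMap.nonneg_iff_isPositive _).mp hM).1
    have he : ∀ (x : H) (h : M x ∈ LinearMap.range M.toLinearMap),
        (LinearEquiv.ofInjective M.toLinearMap hi).symm ⟨M x, h⟩ = x := fun x _ =>
      (LinearEquiv.ofInjective M.toLinearMap hi).symm_apply_apply x
    apply LinearPMap.isSelfAdjoint_of_symmetric_of_maximal
    · change Dense ((LinearMap.range M.toLinearMap : Submodule ℂ H) : Set H)
      rw [Submodule.dense_iff_topologicalClosure_eq_top, Submodule.topologicalClosure_eq_top_iff,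
        Submodule.eq_bot_iff]
      intro y hy
      refine hi ?_
      rw [map_zero]
      refine ext_inner_right ℂ (fun x => ?_)
      rw [hs, inner_zero_left]
      exact Submodule.inner_left_of_mem_orthogonal (LinearMap.mem_range_self M.toLinearMap x) hy
    · rintro ⟨_, x, rfl⟩ ⟨_, y, rfl⟩
      exact (congrArg (fun z => inner ℂ z (M y)) (he x _)).trans
        ((hs x y).symm.trans (congrArg (fun z => inner ℂ (M x) z) (he y _)).symm)
    · intro y w hw
      refine ⟨w, ?_⟩
      refine ext_inner_right ℂ (fun x => ?_)
      have := hw ⟨M x, LinearMap.mem_range_self M.toLinearMap x⟩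
      change inner ℂ w (M x) =
        inner ℂ y ((LinearEquiv.ofInjective M.toLinearMap hi).symm ⟨M x, _⟩) at this
      rw [he] at this
      rw [← this]
      exact hs w x
  nonneg := by
    rintro ⟨_, x, rfl⟩
    change 0 ≤ (inner ℂ (M x) ((LinearEquiv.ofInjective M.toLinearMap hi).symm ⟨M x, _⟩)).re
    rw [show (LinearEquiv.ofInjective M.toLinearMap hi).symm
      ⟨M x, LinearMap.mem_range_self M.toLinearMap x⟩ = x from
      (LinearEquiv.ofInjective M.toLinearMap hi).symm_apply_apply x]
    exact ((ContinuousLinearMap.nonneg_iff_isPositive _).mp hM).re_inner_nonneg_left x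

theorem ofInverse_mem (M : H →L[ℂ] H) (hM : 0 ≤ M) (hi : Function.Injective M) (z : H) :
    M z ∈ (ofInverse M hM hi).toPMap.domain := LinearMap.mem_range_self M.toLinearMap z

theorem ofInverse_apply (M : H →L[ℂ] H) (hM : 0 ≤ M) (hi : Function.Injective M) (z : H) :
    (ofInverse M hM hi).toPMap ⟨M z, ofInverse_mem M hM hi z⟩ = z :=
  (LinearEquiv.ofInjective M.toLinearMap hi).symm_apply_apply z

/-- `(1 + T)^(-1/2)` as a linear map into the form domain. -/
noncomputable def toForm : H →ₗ[ℂ] T.formDomain :=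
  T.sqrtRes.toLinearMap.codRestrict T.formDomain T.sqrtRes_mem

theorem coe_toForm (x : H) : (T.toForm x : H) = T.sqrtRes x := rfl

theorem sqrtForm_toForm (x : H) : T.sqrtForm (T.toForm x) = T.sqrtOneSubRes x :=
  T.sqrtPMap_apply x _

theorem toForm_surjective : Function.Surjective T.toForm := by
  rintro ⟨_, x, rfl⟩
  exact ⟨x, rfl⟩

/-- The squares of √R and √(1-R) add up to the identity. Together with surjectivity, this lets forms
on Q(T) be studied as forms on H. -/
theorem normSqT_toForm (x : H) : T.normSqT (T.toForm x) = ‖x‖ ^ 2 := by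
  have e : ∀ y : H, ‖y‖ ^ 2 = (inner ℂ y y).re := fun y =>
    (inner_self_eq_norm_sq (𝕜 := ℂ) y).symm
  rw [normSqT_eq, sqrtForm_toForm, coe_toForm, e, e, e, inner_sqrtRes, inner_sqrtOneSubRes,
    sqrtRes_sqrtRes, sqrtOneSubRes_sqrtOneSubRes, ← Complex.add_re, ← inner_add_right,
    add_sub_cancel]

theorem denseRange_sqrtRes : DenseRange T.sqrtRes := T.sqrt.isSelfAdjoint.dense_domain

/-- A bounded coercive Hermitian form on `Q(T)` is the form of a positive operator. -/
theorem exists_posOp_of_form (q : T.SesqForm) (hq : ∀ ψ φ, q ψ φ = starRingEnd ℂ (q φ ψ))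
    (K : ℝ) (hK : ∀ ψ, ‖q ψ ψ‖ ≤ K * T.normSqT ψ) (c : ℝ) (hc : 0 < c)
    (hcq : ∀ ψ, c * T.normSqT ψ ≤ (q ψ ψ).re) :
    ∃ (A : PosOp H) (h : A.formDomain = T.formDomain), ∀ ψ φ : T.formDomain,
      A.form ⟨ψ, h.ge ψ.2⟩ ⟨φ, h.ge φ.2⟩ = q ψ φ := by
  obtain ⟨B, hB⟩ := exists_operator_of_bounded_form
    ((q.comp T.toForm).compl₂ T.toForm) K (fun x => by
      rw [← normSqT_toForm]; exact hK _)
  replace hB : ∀ x y, inner ℂ (B x) y = q (T.toForm x) (T.toForm y) := hB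
  have hBs : ∀ x y, inner ℂ (B x) y = inner ℂ x (B y) := by
    intro x y
    rw [← inner_conj_symm x, hB, hB, ← hq]
  have hBc : ∀ x, c * ‖x‖ ^ 2 ≤ (inner ℂ (B x) x).re := by
    intro x
    rw [hB, ← normSqT_toForm]
    exact hcq _
  obtain ⟨u, hu⟩ := isUnit_of_coercive B hBs c hc hBc
  set G : H →L[ℂ] H := ↑u⁻¹ with hG
  have hBG : ∀ x, B (G x) = x := fun x => by
    have : B * G = 1 := by rw [← hu, hG, Units.mul_inv]
    exact congrArg (fun f : H →L[ℂ] H => f x) this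
  have hGB : ∀ x, G (B x) = x := fun x => by
    have : G * B = 1 := by rw [← hu, hG, Units.inv_mul]
    exact congrArg (fun f : H →L[ℂ] H => f x) this
  have hGs : ∀ x y, inner ℂ (G x) y = inner ℂ x (G y) := by
    intro x y
    conv_lhs => rw [← hBG y]
    conv_rhs => rw [← hBG x]
    rw [hBs]
  -- The candidate for A⁻¹: for ψ = √R y one has ⟨ψ, z⟩ = ⟨By, G√R z⟩ = q(ψ, Mz), so the operator
  -- with AMz = z has form q on its domain.
  set M : H →L[ℂ] H := T.sqrtRes * G * T.sqrtRes with hMd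
  have hMa : ∀ x, M x = T.sqrtRes (G (T.sqrtRes x)) := fun x => rfl
  have hM : 0 ≤ M := by
    rw [ContinuousLinearMap.nonneg_iff_isPositive]
    have hs : ∀ x y, inner ℂ (M x) y = inner ℂ x (M y) := by
      intro x y
      rw [hMa, hMa, inner_sqrtRes, hGs, inner_sqrtRes]
    refine ⟨hs, fun x => ?_⟩
    rw [ContinuousLinearMap.reApplyInnerSelf_apply, hMa, inner_sqrtRes]
    have := hBc (G (T.sqrtRes x))
    rw [hBs, hBG] at this
    exact (mul_nonneg hc.le (sq_nonneg _)).trans this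
  have hi : Function.Injective M := by
    have hGi : Function.Injective G := Function.LeftInverse.injective hBG
    exact T.sqrtRes_injective.comp (hGi.comp T.sqrtRes_injective)
  set A := ofInverse M hM hi with hA
  have hD : A.toPMap.domain ≤ T.formDomain := by
    rintro _ ⟨x, rfl⟩
    exact T.sqrtRes_mem _
  have hAx : ∀ (ψ : T.formDomain) (x : A.toPMap.domain),
      inner ℂ (ψ : H) (A.toPMap x) = q ψ ⟨x, hD x.2⟩ := by
    rintro ψ ⟨_, z, rfl⟩
    obtain ⟨y, rfl⟩ := T.toForm_surjective ψ
    have e1 : A.toPMap ⟨M z, ofInverse_mem M hM hi z⟩ = z := ofInverse_apply M hM hi z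
    have e2 : q (T.toForm y) ⟨M z, hD (ofInverse_mem M hM hi z)⟩ =
      inner ℂ (B y) (G (T.sqrtRes z)) := (hB y (G (T.sqrtRes z))).symm
    refine Eq.trans ?_ e2.symm
    rw [hBs, hBG, ← inner_sqrtRes]
    exact congrArg (inner ℂ (T.sqrtRes y)) e1
  have hself : ∀ x : A.toPMap.domain, ‖A.sqrtForm ⟨x, A.domain_le_formDomain x.2⟩‖ ^ 2 =
      (q ⟨x, hD x.2⟩ ⟨x, hD x.2⟩).re := by
    intro x
    rw [← form_self_re, A.form_apply_domain _ x, ← hAx]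
  -- The range of √R is dense and G is invertible. Transported by the unitary √R, this says that the
  -- domain of A is dense in Q(T) for ‖·‖_T.
  have hcore : ∀ x : H, ∃ z : ℕ → H, Tendsto (fun n => G (T.sqrtRes (z n))) atTop (𝓝 x) := by
    intro x
    obtain ⟨s, hs, hs'⟩ := mem_closure_iff_seq_limit.mp (T.denseRange_sqrtRes (B x))
    choose z hz using hs
    refine ⟨z, ?_⟩
    have := (G.continuous.tendsto (B x)).comp hs'
    rw [hGB] at this
    exact this.congr (fun n => by rw [Function.comp_apply, hz])
  have hTA : ∀ ψ : T.formDomain, ∃ (h : (ψ : H) ∈ A.formDomain) (u : ℕ → A.toPMap.domain),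
      Tendsto (fun n => A.sqrtForm ⟨u n, A.domain_le_formDomain (u n).2⟩) atTop
        (𝓝 (A.sqrtForm ⟨ψ, h⟩)) ∧
      ∀ φ : T.formDomain, Tendsto (fun n => q φ ⟨u n, hD (u n).2⟩) atTop (𝓝 (q φ ψ)) := by
    intro ψ
    obtain ⟨x, rfl⟩ := T.toForm_surjective ψ
    obtain ⟨z, hz⟩ := hcore x
    have h1 : Tendsto (fun n => M (z n)) atTop (𝓝 (T.sqrtRes x)) :=
      (T.sqrtRes.continuous.tendsto x).comp hz
    have h2 : Tendsto (fun n => T.sqrtForm ⟨M (z n), hD (ofInverse_mem M hM hi (z n))⟩) atTop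
        (𝓝 (T.sqrtOneSubRes x)) := by
      refine ((T.sqrtOneSubRes.continuous.tendsto x).comp hz).congr (fun n => ?_)
      exact (T.sqrtForm_toForm _).symm
    obtain ⟨h, h'⟩ := T.tendsto_sqrt_of_bound (W := A) A.toPMap.domain hD A.domain_le_formDomain K
      (fun y => by
        rw [hself]
        exact (Complex.re_le_norm _).trans (hK _))
      (u := fun n => ⟨M (z n), ofInverse_mem M hM hi (z n)⟩) h1 h2
    refine ⟨h, _, h', fun φ => ?_⟩
    obtain ⟨y, rfl⟩ := T.toForm_surjective φ
    rw [← hB]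
    refine Tendsto.congr (fun n => hB y (G (T.sqrtRes (z n)))) ?_
    exact tendsto_const_nhds.inner hz
  -- Boundedness of q gave one inclusion through `hTA`; coercivity gives the other, since it
  -- controls T^(1/2) by A^(1/2) on the domain of A.
  have hdom : A.formDomain = T.formDomain := by
    refine le_antisymm (fun ψ hψ => ?_) (fun ψ hψ => (hTA ⟨ψ, hψ⟩).1)
    obtain ⟨u, hu1, hu2⟩ := A.exists_core_seq ⟨ψ, hψ⟩
    refine (A.tendsto_sqrt_of_bound (W := T) A.toPMap.domain A.domain_le_formDomain hD c⁻¹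
      (fun y => ?_) hu1 hu2).1
    rw [normSqT_eq, hself, ← div_eq_inv_mul, le_div_iff₀' hc]
    have h3 := hcq ⟨y, hD y.2⟩
    rw [normSqT_eq] at h3
    nlinarith [sq_nonneg ‖(y : H)‖]
  refine ⟨A, hdom, fun ψ φ => ?_⟩
  obtain ⟨h, u, hu1, hu2⟩ := hTA φ
  refine tendsto_nhds_unique ?_ (hu2 ψ)
  rw [form_eq]
  refine Tendsto.congr (fun n => ?_) (tendsto_const_nhds.inner hu1)
  rw [← form_eq, A.form_apply_domain _ (u n), hAx]

/-! ### Form sums -/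

variable {T}

theorem subLowerBound_apply (C : H →ₗ.[ℂ] H) (hC : IsSelfAdjoint C) (μ : ℝ)
    (hμ : IsLowerBound C μ) (x : C.domain) :
    (subLowerBound C hC μ hμ).toPMap x = C x - (μ : ℂ) • (x : H) := by
  refine (LinearPMap.vadd_apply _ _ _).trans ?_
  rw [LinearMap.smul_apply, LinearMap.id_apply, Complex.ofReal_neg, neg_smul, neg_add_eq_sub]

/-- The representation theorem for form sums. -/
theorem IsFormSum.mem_domain_iff {v : T.SesqForm} {C : H →ₗ.[ℂ] H} (h : T.IsFormSum v C)
    (x y : H) :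
    (∃ hx : x ∈ C.domain, C ⟨x, hx⟩ = y) ↔
      ∃ hx : x ∈ T.formDomain, ∀ φ : T.formDomain,
        T.form φ ⟨x, hx⟩ + v φ ⟨x, hx⟩ = inner ℂ (φ : H) y := by
  obtain ⟨hC, μ, hμ, hQ, hf⟩ := h
  have key := (subLowerBound C hC μ hμ).mem_domain_iff_form x (y - (μ : ℂ) • x)
  have e1 : (∃ hx : x ∈ C.domain, C ⟨x, hx⟩ = y) ↔
      ∃ hx : x ∈ (subLowerBound C hC μ hμ).toPMap.domain,
        (subLowerBound C hC μ hμ).toPMap ⟨x, hx⟩ = y - (μ : ℂ) • x := by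
    refine exists_congr (fun hx => ?_)
    rw [show (subLowerBound C hC μ hμ).toPMap ⟨x, hx⟩ = _ from
      subLowerBound_apply C hC μ hμ ⟨x, hx⟩]
    exact sub_left_inj.symm
  rw [e1, key]
  constructor
  · rintro ⟨hx, hx'⟩
    refine ⟨hQ.le hx, fun φ => ?_⟩
    rw [← hf, hx' ⟨φ, hQ.ge φ.2⟩, inner_sub_right, inner_smul_right, sub_add_cancel]
  · rintro ⟨hx, hx'⟩
    refine ⟨hQ.ge hx, fun φ => ?_⟩
    have := hf ⟨φ, hQ.le φ.2⟩ ⟨x, hx⟩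
    rw [hx'] at this
    rw [inner_sub_right, inner_smul_right]
    exact eq_sub_of_add_eq this

/-- `mem_domain_iff` describes the graph by t + v alone; the lower bound chosen in `IsFormSum` has
disappeared from it. -/
theorem IsFormSum.unique {v : T.SesqForm} {C C' : H →ₗ.[ℂ] H} (h : T.IsFormSum v C)
    (h' : T.IsFormSum v C') : C = C' := by
  refine LinearPMap.eq_of_eq_graph ?_
  ext ⟨x, y⟩
  rw [LinearPMap.mem_graph_iff, LinearPMap.mem_graph_iff]
  have e : ∀ D : H →ₗ.[ℂ] H, (∃ z : D.domain, (z : H) = x ∧ D z = y) ↔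
      ∃ hx : x ∈ D.domain, D ⟨x, hx⟩ = y := by
    intro D
    constructor
    · rintro ⟨z, rfl, hz⟩
      exact ⟨z.2, hz⟩
    · rintro ⟨hx, hz⟩
      exact ⟨⟨x, hx⟩, rfl, hz⟩
  exact ((e C).trans (h.mem_domain_iff x y)).trans
    ((h'.mem_domain_iff x y).symm.trans (e C').symm)

theorem IsFormSum.isLowerBound {v : T.SesqForm} {C : H →ₗ.[ℂ] H} (h : T.IsFormSum v C) (m : ℝ)
    (hm : ∀ ψ : T.formDomain, m * ‖(ψ : H)‖ ^ 2 ≤ (T.form ψ ψ + v ψ ψ).re) : IsLowerBound C m := by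
  intro x
  obtain ⟨hx, hx'⟩ := (h.mem_domain_iff x (C x)).mp ⟨x.2, rfl⟩
  have := hm ⟨x, hx⟩
  rwa [hx' ⟨x, hx⟩] at this

/-- The form of `C - μ`, for any lower bound `μ` of a form sum `C`. -/
theorem IsFormSum.subLowerBound_form {v : T.SesqForm} {C : H →ₗ.[ℂ] H} (h : T.IsFormSum v C)
    (hC : IsSelfAdjoint C) (μ : ℝ) (hμ : IsLowerBound C μ) (ψ : T.formDomain) :
    ∃ hψ : (ψ : H) ∈ (subLowerBound C hC μ hμ).formDomain,
      ‖(subLowerBound C hC μ hμ).sqrtForm ⟨ψ, hψ⟩‖ ^ 2 =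
        ‖T.sqrtForm ψ‖ ^ 2 + (v ψ ψ).re - μ * ‖(ψ : H)‖ ^ 2 := by
  obtain ⟨hC', ν, hν, hQ, hf⟩ := h
  obtain ⟨hψ, e⟩ := (subLowerBound C hC' ν hν).form_of_shift_aux (W := subLowerBound C hC μ hμ)
    (ν - μ) le_rfl (fun x => by
      refine (subLowerBound_apply C hC μ hμ x).trans ?_
      rw [show (subLowerBound C hC' ν hν).toPMap x = _ from subLowerBound_apply C hC' ν hν x,
        Complex.ofReal_sub, sub_smul]
      abel) ⟨ψ, hQ.ge ψ.2⟩
  refine ⟨hψ, ?_⟩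
  rw [e]
  have h1 := congrArg Complex.re (hf ψ ψ)
  rw [Complex.add_re, Complex.add_re, form_self_re, form_self_re, Complex.re_ofReal_mul,
    show (inner ℂ (ψ : H) (ψ : H)).re = ‖(ψ : H)‖ ^ 2 from inner_self_eq_norm_sq (𝕜 := ℂ) _] at h1
  simp only
  linarith

/-- The form of `T` as a sesquilinear map. -/
noncomputable def formMap (T : PosOp H) : T.SesqForm :=
  ((innerₛₗ ℂ).comp T.sqrtForm).compl₂ T.sqrtForm

/-- The inner product as a sesquilinear map on the form domain. -/
noncomputable def innerMap (T : PosOp H) : T.SesqForm :=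
  ((innerₛₗ ℂ).comp T.formDomain.subtype).compl₂ T.formDomain.subtype

theorem HasRelBound.re_form_le {v : T.SesqForm} {a b : ℝ} (h : T.HasRelBound v a b)
    (ψ : T.formDomain) :
    |(v ψ ψ).re| ≤ a * ‖T.sqrtForm ψ‖ ^ 2 + b * ‖(ψ : H)‖ ^ 2 := by
  rw [← form_self_re]
  exact (Complex.abs_re_le_norm _).trans (h.2.2 ψ)

/-- The KLMN theorem. -/
theorem exists_isFormSum (v : T.SesqForm) (hv : ∀ ψ φ, v ψ φ = starRingEnd ℂ (v φ ψ))
    {a b : ℝ} (ha : a < 1) (h : T.HasRelBound v a b) :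
    ∃ C : H →ₗ.[ℂ] H, T.IsFormSum v C ∧ IsLowerBound C (-b) := by
  -- The shift b absorbs the negative part of v, and the extra 1 leaves (1-a)‖T^(1/2)ψ‖² + ‖ψ‖²,
  -- which is at least (1-a)‖ψ‖_T².
  set β : ℝ := b + 1 with hβ
  set q : T.SesqForm := T.formMap + v + (β : ℂ) • T.innerMap with hq
  have hqa : ∀ ψ φ, q ψ φ = T.form ψ φ + v ψ φ + (β : ℂ) * inner ℂ (ψ : H) (φ : H) :=
    fun ψ φ => rfl
  have hin : ∀ ψ : T.formDomain, inner ℂ (ψ : H) (ψ : H) = ((‖(ψ : H)‖ ^ 2 : ℝ) : ℂ) := by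
    intro ψ
    rw [inner_self_eq_norm_sq_to_K]
    norm_cast
  have hre : ∀ ψ, (q ψ ψ).re = ‖T.sqrtForm ψ‖ ^ 2 + (v ψ ψ).re + β * ‖(ψ : H)‖ ^ 2 := by
    intro ψ
    rw [hqa, hin, Complex.add_re, Complex.add_re, form_self_re, Complex.re_ofReal_mul,
      Complex.ofReal_re]
  obtain ⟨A, hA, hf⟩ := T.exists_posOp_of_form q (fun ψ φ => by
      rw [hqa, hqa, map_add, map_add, map_mul, Complex.conj_ofReal, inner_conj_symm, ← hv,
        form_eq, form_eq, inner_conj_symm])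
    (1 + a + b + β) (fun ψ => by
      rw [hqa, hin, form_self]
      refine (norm_add_le _ _).trans ((add_le_add_left (norm_add_le _ _) _).trans ?_)
      rw [norm_mul, Complex.norm_real, Complex.norm_real, Complex.norm_real,
        Real.norm_of_nonneg (sq_nonneg _), Real.norm_of_nonneg (sq_nonneg _),
        Real.norm_of_nonneg (show 0 ≤ β by linarith [h.2.1]), normSqT_eq]
      have h1 := h.2.2 ψ
      rw [form_self_re] at h1
      have ha0 := h.1
      have hb0 := h.2.1
      have hβ0 : 0 ≤ β := by linarith
      nlinarith [sq_nonneg ‖T.sqrtForm ψ‖, sq_nonneg ‖(ψ : H)‖,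
        mul_nonneg ha0 (sq_nonneg ‖(ψ : H)‖), mul_nonneg hb0 (sq_nonneg ‖T.sqrtForm ψ‖),
        mul_nonneg hβ0 (sq_nonneg ‖T.sqrtForm ψ‖)])
    (1 - a) (sub_pos.mpr ha) (fun ψ => by
      rw [hre, normSqT_eq]
      have h1 := (abs_le.mp (h.re_form_le ψ)).1
      nlinarith [mul_nonneg h.1 (sq_nonneg ‖(ψ : H)‖)])
  set C : H →ₗ.[ℂ] H := (((-β : ℝ) : ℂ) • (LinearMap.id : H →ₗ[ℂ] H)) +ᵥ A.toPMap with hCd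
  have hCa : ∀ x : A.toPMap.domain, C x = A.toPMap x - (β : ℂ) • (x : H) := by
    intro x
    refine (LinearPMap.vadd_apply _ _ _).trans ?_
    rw [LinearMap.smul_apply, LinearMap.id_apply, Complex.ofReal_neg, neg_smul, neg_add_eq_sub]
  have hC : IsSelfAdjoint C := LinearPMap.isSelfAdjoint_real_smul_vadd A.isSelfAdjoint (-β)
  have hμ : IsLowerBound C (-β) := by
    intro x
    rw [hCa, inner_sub_right, inner_smul_right, Complex.sub_re, Complex.re_ofReal_mul,
      show (inner ℂ (x : H) (x : H)).re = ‖(x : H)‖ ^ 2 from inner_self_eq_norm_sq (𝕜 := ℂ) _]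
    linarith [A.nonneg x]
  have e : subLowerBound C hC (-β) hμ = A := by
    refine ext_toPMap (LinearPMap.ext' ?_)
    ext x
    refine (subLowerBound_apply C hC (-β) hμ x).trans ?_
    rw [hCa, Complex.ofReal_neg, neg_smul, sub_neg_eq_add, sub_add_cancel]
    rfl
  have hsum : T.IsFormSum v C := by
    have key : ∀ A' : PosOp H, A' = A → ∃ hQ : A'.formDomain = T.formDomain,
        ∀ ψ φ : T.formDomain, A'.form ⟨ψ, hQ.ge ψ.2⟩ ⟨φ, hQ.ge φ.2⟩ +
          ((-β : ℝ) : ℂ) * inner ℂ (ψ : H) (φ : H) = T.form ψ φ + v ψ φ := by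
      rintro _ rfl
      refine ⟨hA, fun ψ φ => ?_⟩
      rw [hf, hqa, Complex.ofReal_neg]
      ring
    exact ⟨hC, -β, hμ, key _ e⟩
  -- The construction only yields the lower bound -b-1; the sharp one is read off from t + v ≥
  -- (1-a)t - b.
  refine ⟨C, hsum, hsum.isLowerBound (-b) (fun ψ : T.formDomain => ?_)⟩
  rw [Complex.add_re, form_self_re]
  have h1 := (abs_le.mp (h.re_form_le ψ)).1
  nlinarith [sq_nonneg ‖T.sqrtForm ψ‖]

end

end PosOp

theorem abs_le_mul_of_hasSum {ι : Type*} {f g : ι → ℝ} {x y M : ℝ} (hf : HasSum f x)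
    (hg : HasSum g y) (h : ∀ i, |f i| ≤ M * g i) : |x| ≤ M * y := by
  rw [abs_le, ← neg_mul]
  exact ⟨hasSum_le (fun i => by rw [neg_mul]; exact (abs_le.mp (h i)).1) (hg.mul_left (-M)) hf,
    hasSum_le (fun i => (abs_le.mp (h i)).2) hf (hg.mul_left M)⟩

namespace PosOp

section

variable {H : Type*} [NormedAddCommGroup H] [InnerProductSpace ℂ H] [CompleteSpace H]
variable (T : PosOp H)

/-! ### The form of a functional on `X` -/

/-- This is |ψ+φ⟩⟨ψ+φ| - |ψ⟩⟨ψ| - |φ⟩⟨φ|. A functional takes the value 2 Re v_ω(ψ,φ) on it, and the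
rules below are the sesquilinearity of v_ω at operator level. -/
theorem cross_mem_X (ψ φ : T.formDomain) :
    InnerProductSpace.rankOne ℂ (φ : H) (ψ : H) + InnerProductSpace.rankOne ℂ (ψ : H) (φ : H) ∈
      T.X := by
  have h := T.X.sub_mem (T.X.sub_mem (T.rankOne_mem_X (ψ + φ)) (T.rankOne_mem_X ψ))
    (T.rankOne_mem_X φ)
  convert h using 1
  simp only [Submodule.coe_add, map_add, add_apply]
  abel

/-- The operator `|φ⟩⟨ψ| + |ψ⟩⟨φ|`. -/
noncomputable def cross (ψ φ : T.formDomain) : T.X := ⟨_, T.cross_mem_X ψ φ⟩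

theorem coe_cross (ψ φ : T.formDomain) : (T.cross ψ φ : H →L[ℂ] H) =
    InnerProductSpace.rankOne ℂ (φ : H) (ψ : H) + InnerProductSpace.rankOne ℂ (ψ : H) (φ : H) :=
  rfl

theorem cross_comm (ψ φ : T.formDomain) : T.cross ψ φ = T.cross φ ψ :=
  Subtype.ext (add_comm _ _)

theorem cross_add (ψ φ χ : T.formDomain) : T.cross ψ (φ + χ) = T.cross ψ φ + T.cross ψ χ := by
  apply Subtype.ext
  simp only [Submodule.coe_add, coe_cross, map_add, add_apply]
  abel

theorem cross_smul (c : ℂ) (ψ φ : T.formDomain) :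
    T.cross ψ (c • φ) = c.re • T.cross ψ φ + c.im • T.cross ψ (Complex.I • φ) := by
  apply Subtype.ext
  simp only [Submodule.coe_add, Submodule.coe_smul, coe_cross, map_smul, map_smulₛₗ,
    smul_apply, Complex.conj_I, ← Complex.coe_smul]
  conv_lhs => rw [← Complex.re_add_im c]
  rw [map_add, map_mul, Complex.conj_I, Complex.conj_ofReal, Complex.conj_ofReal]
  module

theorem cross_I_smul_I_smul (ψ φ : T.formDomain) :
    T.cross (Complex.I • ψ) (Complex.I • φ) = T.cross ψ φ := by
  apply Subtype.ext
  simp only [Submodule.coe_smul, coe_cross, map_smul, map_smulₛₗ,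
    smul_apply, Complex.conj_I, smul_smul]
  simp

theorem cross_I_smul_I_smul_right (ψ φ : T.formDomain) :
    T.cross ψ (Complex.I • Complex.I • φ) = - T.cross ψ φ := by
  rw [cross_smul]
  simp only [Complex.I_re, Complex.I_im, zero_smul, one_smul, zero_add]
  rw [smul_smul, Complex.I_mul_I, cross_smul]
  simp only [Complex.neg_re, Complex.neg_im, Complex.one_re, Complex.one_im, neg_zero, zero_smul,
    add_zero]
  exact neg_one_smul ℝ (T.cross ψ φ)

theorem cross_I_smul_left (ψ φ : T.formDomain) :
    T.cross (Complex.I • ψ) φ = - T.cross ψ (Complex.I • φ) := by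
  rw [← T.cross_I_smul_I_smul ψ (Complex.I • φ), cross_I_smul_I_smul_right, neg_neg]

theorem cross_self (ψ : T.formDomain) :
    T.cross ψ ψ = (2 : ℝ) • ⟨_, T.rankOne_mem_X ψ⟩ := by
  apply Subtype.ext
  rw [Submodule.coe_smul, two_smul, coe_cross]

/-- By symmetry and the rule for i in the first slot it equals its own negative. This makes v_ω(ψ,ψ)
real. -/
theorem cross_self_I_smul (ψ : T.formDomain) : T.cross ψ (Complex.I • ψ) = 0 := by
  have h := T.cross_I_smul_left ψ ψ
  rw [cross_comm] at h
  have h2 : (2 : ℝ) • T.cross ψ (Complex.I • ψ) = 0 := by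
    rw [two_smul, ← eq_neg_iff_add_eq_zero]
    exact h
  exact (smul_eq_zero.mp h2).resolve_left two_ne_zero

/-- The sesquilinear form of a functional on `X`, before linearity is known. -/
noncomputable def formFun (ω : T.X →ₗ[ℝ] ℝ) (ψ φ : T.formDomain) : ℂ :=
  -- The imaginary part is forced by linearity in φ: Re v(ψ, iφ) = -Im v(ψ, φ).
  ⟨ω (T.cross ψ φ) / 2, -(ω (T.cross ψ (Complex.I • φ)) / 2)⟩

theorem formFun_symm (ω : T.X →ₗ[ℝ] ℝ) (ψ φ : T.formDomain) :
    T.formFun ω ψ φ = starRingEnd ℂ (T.formFun ω φ ψ) := by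
  apply Complex.ext
  · simp only [formFun, Complex.conj_re, T.cross_comm φ ψ]
  · simp only [formFun, Complex.conj_im, neg_neg]
    rw [← T.cross_comm (Complex.I • ψ), cross_I_smul_left, map_neg, neg_div]

theorem formFun_add (ω : T.X →ₗ[ℝ] ℝ) (ψ φ χ : T.formDomain) :
    T.formFun ω ψ (φ + χ) = T.formFun ω ψ φ + T.formFun ω ψ χ := by
  apply Complex.ext <;>
  simp only [formFun, cross_add, smul_add, map_add, Complex.add_re, Complex.add_im] <;> ring

theorem formFun_smul (ω : T.X →ₗ[ℝ] ℝ) (c : ℂ) (ψ φ : T.formDomain) :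
    T.formFun ω ψ (c • φ) = c • T.formFun ω ψ φ := by
  have h1 : ω (T.cross ψ (c • φ)) =
      c.re * ω (T.cross ψ φ) + c.im * ω (T.cross ψ (Complex.I • φ)) := by
    rw [cross_smul, map_add, map_smul, map_smul, smul_eq_mul, smul_eq_mul]
  have h2 : ω (T.cross ψ (Complex.I • c • φ)) =
      c.re * ω (T.cross ψ (Complex.I • φ)) - c.im * ω (T.cross ψ φ) := by
    rw [smul_comm, cross_smul, cross_I_smul_I_smul_right, map_add, map_smul, map_smul, map_neg,
      smul_eq_mul, smul_eq_mul, mul_neg, sub_eq_add_neg]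
  apply Complex.ext
  · simp only [formFun, h1, smul_eq_mul, Complex.mul_re]
    ring
  · simp only [formFun, h2, smul_eq_mul, Complex.mul_im]
    ring

/-- The sesquilinear form of a functional on `X`. -/
noncomputable def functionalForm (ω : T.X →ₗ[ℝ] ℝ) : T.SesqForm :=
  LinearMap.mk₂'ₛₗ (starRingEnd ℂ) (RingHom.id ℂ) (T.formFun ω)
    (fun ψ φ χ => by
      rw [formFun_symm, formFun_add, map_add, ← formFun_symm, ← formFun_symm])
    (fun c ψ φ => by
      rw [formFun_symm, formFun_smul, smul_eq_mul, map_mul, ← formFun_symm, smul_eq_mul])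
    (T.formFun_add ω)
    (fun c ψ φ => T.formFun_smul ω c ψ φ)

theorem functionalForm_apply (ω : T.X →ₗ[ℝ] ℝ) (ψ φ : T.formDomain) :
    T.functionalForm ω ψ φ = T.formFun ω ψ φ := rfl

theorem functionalForm_self (ω : T.X →ₗ[ℝ] ℝ) (ψ : T.formDomain) :
    T.functionalForm ω ψ ψ = ((ω ⟨_, T.rankOne_mem_X ψ⟩ : ℝ) : ℂ) := by
  apply Complex.ext
  · rw [functionalForm_apply, formFun, cross_self, map_smul, smul_eq_mul, Complex.ofReal_re]
    ring
  · rw [functionalForm_apply, formFun, cross_self_I_smul, map_zero, Complex.ofReal_im]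
    simp

theorem functionalForm_mem {ω : T.X →ₗ[ℝ] ℝ} (hω : ω ∈ T.dualX) :
    T.functionalForm ω ∈ T.formSpace := by
  obtain ⟨C, hC, h⟩ := hω
  refine ⟨T.formFun_symm ω, C, hC, fun ψ => ?_⟩
  rw [functionalForm_self, Complex.norm_real]
  exact (h _).trans (mul_le_mul_of_nonneg_left (T.normX_rankOne_le ψ) hC.le)

/-- The map `ω ↦ v_ω` from `X*` to `F(T)`. -/
noncomputable def dualToForm : T.dualX →ₗ[ℝ] T.formSpace where
  toFun ω := ⟨T.functionalForm ω, T.functionalForm_mem ω.2⟩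
  map_add' ω η := by
    apply Subtype.ext
    ext ψ φ
    change T.formFun _ ψ φ = T.formFun _ ψ φ + T.formFun _ ψ φ
    apply Complex.ext <;>
    simp only [formFun, Submodule.coe_add, LinearMap.add_apply, Complex.add_re,
      Complex.add_im] <;> ring
  map_smul' c ω := by
    apply Subtype.ext
    ext ψ φ
    change T.formFun _ ψ φ = c • T.formFun _ ψ φ
    apply Complex.ext <;>
    simp only [formFun, Submodule.coe_smul, LinearMap.smul_apply, smul_eq_mul, Complex.real_smul,
      Complex.re_ofReal_mul, Complex.im_ofReal_mul] <;> ring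

theorem dualToForm_self (ω : T.dualX) (ψ : T.formDomain) :
    (T.dualToForm ω : T.SesqForm) ψ ψ = (((ω : T.X →ₗ[ℝ] ℝ) ⟨_, T.rankOne_mem_X ψ⟩ : ℝ) : ℂ) :=
  T.functionalForm_self ω ψ

/-! ### Recovering functionals from forms, and the trace formula -/

variable {T}

theorem hasSum_dualToForm (ω : T.dualX) {γ : H →L[ℂ] H} (hγ : γ ∈ T.XPlus) :
    HasSum (fun i => ((T.dualToForm ω : T.SesqForm) (T.formVec hγ i) (T.formVec hγ i)).re)
      ((ω : T.X →ₗ[ℝ] ℝ) ⟨γ, T.mem_X_of_mem_XPlus hγ⟩) := by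
  refine (T.hasSum_dualX ω ω.2 hγ).congr_fun (fun i => ?_)
  rw [dualToForm_self, Complex.ofReal_re]

/-- A functional on `X` evaluated on a difference. -/
theorem apply_X (ω : T.X →ₗ[ℝ] ℝ) (γ : T.X) {a b : H →L[ℂ] H} (ha : a ∈ T.XPlus)
    (hb : b ∈ T.XPlus) (h : (γ : H →L[ℂ] H) = a - b) :
    ω γ = ω ⟨a, T.mem_X_of_mem_XPlus ha⟩ - ω ⟨b, T.mem_X_of_mem_XPlus hb⟩ := by
  rw [← map_sub]
  congr 1
  exact Subtype.ext h

theorem dualToForm_injective : Function.Injective T.dualToForm := by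
  rw [injective_iff_map_eq_zero]
  intro ω hω
  apply Subtype.ext
  ext γ
  have h0 : ∀ {a : H →L[ℂ] H} (ha : a ∈ T.XPlus),
      (ω : T.X →ₗ[ℝ] ℝ) ⟨a, T.mem_X_of_mem_XPlus ha⟩ = 0 := by
    intro a ha
    refine (hasSum_dualToForm ω ha).unique ?_
    rw [hω]
    simp
  obtain ⟨a, ha, b, hb, e⟩ := γ.2
  rw [apply_X _ γ ha hb e, h0 ha, h0 hb, sub_zero]
  rfl

/-- If |v(ψ,ψ)| ≤ C‖ψ‖_T², then a = b = cC serves, and it is below one for c < 1/C. -/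
theorem exists_hasRelBound (v : T.formSpace) : ∃ c₀ > 0, ∀ c : ℝ, 0 < c → c < c₀ →
    ∃ a b : ℝ, a < 1 ∧ T.HasRelBound ((c • v : T.formSpace) : T.SesqForm) a b := by
  obtain ⟨v, hv, C, hC, h⟩ := v
  refine ⟨C⁻¹, inv_pos.mpr hC, fun c hc hc' => ⟨c * C, c * C, ?_, by positivity, by positivity,
    fun ψ => ?_⟩⟩
  · rw [← lt_div_iff₀ hC, one_div]
    exact hc'
  · change ‖c • v ψ ψ‖ ≤ _
    rw [norm_smul, Real.norm_of_nonneg hc.le, form_self_re, mul_assoc, mul_assoc, ← mul_add,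
      ← mul_add]
    refine mul_le_mul_of_nonneg_left ((h ψ).trans (le_of_eq ?_)) hc.le
    rw [normSqT_eq, add_comm]

section

variable {v : T.formSpace} {c : ℝ} {C : H →ₗ.[ℂ] H}

/-- On Q(T) the form of C - μ is at most (1 + K + |μ|)‖ψ‖_T², where K bounds cv, and ‖·‖_T² is
summable along √γ e_i. -/
theorem IsFormSum.XPlus_subset (h : T.IsFormSum ((c • v : T.formSpace) : T.SesqForm) C)
    (hC : IsSelfAdjoint C) (μ : ℝ) (hμ : IsLowerBound C μ) :
    T.XPlus ⊆ (subLowerBound C hC μ hμ).XPlus := by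
  intro γ hγ
  obtain ⟨hv, K, hK, hb⟩ := (c • v : T.formSpace).2
  have hf := h.subLowerBound_form hC μ hμ
  refine mem_XPlus_of_summable _ hγ.1 (fun i => (hf (T.formVec hγ i)).choose) ?_
  refine Summable.of_nonneg_of_le (fun _ => sq_nonneg _) (fun i => ?_)
    ((T.summable_normSqT hγ).summable.mul_left (1 + K + |μ|))
  refine (hf (T.formVec hγ i)).choose_spec.le.trans ?_
  have h1 := (Complex.re_le_norm _).trans (hb (T.formVec hγ i))
  have h2 := neg_abs_le μ
  rw [normSqT_eq] at h1 ⊢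
  nlinarith [sq_nonneg ‖T.sqrtForm (T.formVec hγ i)‖, sq_nonneg ‖(T.formVec hγ i : H)‖,
    mul_nonneg (abs_nonneg μ) (sq_nonneg ‖T.sqrtForm (T.formVec hγ i)‖),
    mul_nonneg (neg_le_iff_add_nonneg.mp h2) (sq_nonneg ‖(T.formVec hγ i : H)‖)]

/-- The trace formula, summed from its version for single vectors. The series depends on neither c,
C nor μ, and it is the one in `hasSum_dualToForm` when v = v_ω. -/
theorem IsFormSum.hasSum (hc : 0 < c) (h : T.IsFormSum ((c • v : T.formSpace) : T.SesqForm) C)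
    (hC : IsSelfAdjoint C) (μ : ℝ) (hμ : IsLowerBound C μ) {γ : H →L[ℂ] H} (hγ : γ ∈ T.XPlus) :
    HasSum (fun i => ((v : T.SesqForm) (T.formVec hγ i) (T.formVec hγ i)).re)
      (c⁻¹ * (((subLowerBound C hC μ hμ).traceMul γ).toReal - (T.traceMul γ).toReal +
        μ * (opTrace γ).re)) := by
  have h1 := (subLowerBound C hC μ hμ).hasSum_traceMul (h.XPlus_subset hC μ hμ hγ)
  refine (((h1.sub (T.hasSum_traceMul hγ)).add
    ((hasSum_re_opTrace hγ.1).mul_left μ)).mul_left c⁻¹).congr_fun (fun i => ?_)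
  obtain ⟨hψ, e⟩ := h.subLowerBound_form hC μ hμ (T.formVec hγ i)
  have e2 : (((c • v : T.formSpace) : T.SesqForm) (T.formVec hγ i) (T.formVec hγ i)).re =
      c * ((v : T.SesqForm) (T.formVec hγ i) (T.formVec hγ i)).re := by
    rw [← Complex.re_ofReal_mul]
    rfl
  rw [e2] at e
  have e3 : ‖(subLowerBound C hC μ hμ).sqrtForm
      ((subLowerBound C hC μ hμ).formVec (h.XPlus_subset hC μ hμ hγ) i)‖ ^ 2 =
      ‖T.sqrtForm (T.formVec hγ i)‖ ^ 2 +
      c * ((v : T.SesqForm) (T.formVec hγ i) (T.formVec hγ i)).re - μ * ‖sqrtVec γ i‖ ^ 2 := e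
  rw [e3]
  field_simp
  ring

theorem IsFormSum.traceMul_rankOne (h : T.IsFormSum ((c • v : T.formSpace) : T.SesqForm) C)
    (hC : IsSelfAdjoint C) (μ : ℝ) (hμ : IsLowerBound C μ) (ψ : T.formDomain) :
    ((subLowerBound C hC μ hμ).traceMul
      (InnerProductSpace.rankOne ℂ (ψ : H) (ψ : H))).toReal =
      ‖T.sqrtForm ψ‖ ^ 2 + c * ((v : T.SesqForm) ψ ψ).re - μ * ‖(ψ : H)‖ ^ 2 := by
  obtain ⟨hψ, e⟩ := h.subLowerBound_form hC μ hμ ψ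
  have e2 : (((c • v : T.formSpace) : T.SesqForm) ψ ψ).re = c * ((v : T.SesqForm) ψ ψ).re := by
    rw [← Complex.re_ofReal_mul]
    rfl
  refine Eq.trans ?_ (e.trans (by rw [e2]))
  exact PosOp.traceMul_rankOne (subLowerBound C hC μ hμ) ⟨(ψ : H), hψ⟩

end

theorem dualToForm_surjective : Function.Surjective T.dualToForm := by
  intro v
  obtain ⟨hv, K, hK, hb⟩ := v.2
  obtain ⟨c₀, hc₀, hc₀'⟩ := exists_hasRelBound v
  obtain ⟨a, b, ha, hab⟩ := hc₀' (c₀ / 2) (half_pos hc₀) (half_lt_self hc₀)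
  set c := c₀ / 2 with hcd
  have hc : 0 < c := half_pos hc₀
  obtain ⟨C, hC, -⟩ := exists_isFormSum _ (c • v).2.1 ha hab
  obtain ⟨hCs, μ, hμ, -, -⟩ := id hC
  obtain ⟨τ, hτ⟩ := (subLowerBound C hCs μ hμ).exists_linear_traceMul T
    (hC.XPlus_subset hCs μ hμ)
  obtain ⟨σ, hσ⟩ := T.exists_linear_traceMul T le_rfl
  -- The trace formula taken as a definition, at one admissible scale c. Its series representation
  -- bounds it by K, and its values at rank-one operators are v(ψ,ψ); polarization then identifies
  -- its form with v.
  set ω : T.X →ₗ[ℝ] ℝ := c⁻¹ • (τ - σ + μ • T.traceFunctional 1) with hω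
  have hωa : ∀ γ : T.X, (γ : H →L[ℂ] H) ∈ T.XPlus → ω γ =
      c⁻¹ * (((subLowerBound C hCs μ hμ).traceMul (γ : H →L[ℂ] H)).toReal -
        (T.traceMul (γ : H →L[ℂ] H)).toReal + μ * (opTrace (γ : H →L[ℂ] H)).re) := by
    intro γ hγ
    rw [hω, LinearMap.smul_apply, LinearMap.add_apply, LinearMap.sub_apply, LinearMap.smul_apply,
      hτ γ hγ, hσ γ hγ, traceFunctional_apply, one_mul, smul_eq_mul, smul_eq_mul]
  have hωb : ∀ {γ : H →L[ℂ] H} (hγ : γ ∈ T.XPlus),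
      |ω ⟨γ, T.mem_X_of_mem_XPlus hγ⟩| ≤ K * (T.oneAdd.traceMul γ).toReal := by
    intro γ hγ
    rw [hωa _ hγ]
    exact abs_le_mul_of_hasSum (hC.hasSum hc hCs μ hμ hγ) (T.hasSum_normSqT hγ)
      (fun i => (Complex.abs_re_le_norm _).trans (hb _))
  have hωd : ω ∈ T.dualX := by
    refine ⟨K, hK, fun γ => T.le_mul_normX γ hK.le (fun a ha b hb e => ?_)⟩
    rw [apply_X ω γ ha hb e, mul_add]
    exact (abs_sub _ _).trans (add_le_add (hωb ha) (hωb hb))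
  have hωψ : ∀ ψ : T.formDomain, ω ⟨_, T.rankOne_mem_X ψ⟩ = ((v : T.SesqForm) ψ ψ).re := by
    intro ψ
    have h1 : (opTrace (InnerProductSpace.rankOne ℂ (ψ : H) (ψ : H))).re = ‖(ψ : H)‖ ^ 2 := by
      rw [← one_mul (InnerProductSpace.rankOne ℂ (ψ : H) (ψ : H)), opTrace_mul_rankOne]
      exact inner_self_eq_norm_sq (𝕜 := ℂ) _
    rw [hωa _ (T.rankOne_mem_XPlus ψ), hC.traceMul_rankOne, T.traceMul_rankOne, h1]
    field_simp
    ring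
  have hdiag : ∀ ψ : T.formDomain, T.functionalForm ω ψ ψ = (v : T.SesqForm) ψ ψ := by
    intro ψ
    rw [functionalForm_self, hωψ]
    exact Complex.conj_eq_iff_re.mp (hv ψ ψ).symm
  refine ⟨⟨ω, hωd⟩, Subtype.ext ?_⟩
  change T.functionalForm ω = (v : T.SesqForm)
  ext ψ φ
  rw [sesq_polarization, sesq_polarization (v : T.SesqForm)]
  simp only [hdiag]

/-! ### The isometry -/

theorem abs_apply_le_normDual (ω : T.dualX) (γ : T.X) :
    |(ω : T.X →ₗ[ℝ] ℝ) γ| ≤ T.normDual ω * T.normX γ := by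
  obtain ⟨C, hC, h⟩ := ω.2
  -- For vanishing norm the quotient has the default value 0 and says nothing about ω γ; the bound
  -- in the definition of X* forces ω γ = 0 there.
  rcases (T.normX_nonneg γ).eq_or_lt with h0 | h0
  · have := h γ
    rwa [← h0, mul_zero] at this ⊢
  · rw [← div_le_iff₀ h0]
    exact le_ciSup (f := fun γ : T.X => |(ω : T.X →ₗ[ℝ] ℝ) γ| / T.normX γ)
      ⟨C, by rintro _ ⟨δ, rfl⟩; exact div_le_of_le_mul₀ (T.normX_nonneg δ) hC.le (h δ)⟩ γ

theorem norm_apply_le_normForm (v : T.formSpace) (ψ : T.formDomain) :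
    ‖(v : T.SesqForm) ψ ψ‖ ≤ T.normForm v * T.normSqT ψ := by
  obtain ⟨-, C, hC, h⟩ := v.2
  rcases (T.normSqT_nonneg ψ).eq_or_lt with h0 | h0
  · have := h ψ
    rwa [← h0, mul_zero] at this ⊢
  · rw [← div_le_iff₀ h0]
    exact le_ciSup (f := fun ψ : T.formDomain => ‖(v : T.SesqForm) ψ ψ‖ / T.normSqT ψ)
      ⟨C, by rintro _ ⟨φ, rfl⟩; exact div_le_of_le_mul₀ (T.normSqT_nonneg φ) hC.le (h φ)⟩ ψ

/-- Rank-one operators give ≤, for which the inequality ‖|ψ⟩⟨ψ|‖_X ≤ ‖ψ‖_T² suffices. For ≥, the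
series for ω is compared termwise with ∑ ‖s_i‖_T² on both parts of any decomposition. -/
theorem normForm_dualToForm (ω : T.dualX) :
    T.normForm (T.dualToForm ω : T.SesqForm) = T.normDual (ω : T.X →ₗ[ℝ] ℝ) := by
  have h0 : 0 ≤ T.normDual (ω : T.X →ₗ[ℝ] ℝ) :=
    Real.iSup_nonneg (fun γ => div_nonneg (abs_nonneg _) (T.normX_nonneg γ))
  have h0' : 0 ≤ T.normForm (T.dualToForm ω : T.SesqForm) :=
    Real.iSup_nonneg (fun ψ => div_nonneg (norm_nonneg _) (T.normSqT_nonneg ψ))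
  refine le_antisymm (Real.iSup_le (fun ψ => ?_) h0) (Real.iSup_le (fun γ => ?_) h0')
  · refine div_le_of_le_mul₀ (T.normSqT_nonneg ψ) h0 ?_
    rw [dualToForm_self, Complex.norm_real]
    exact (abs_apply_le_normDual ω _).trans
      (mul_le_mul_of_nonneg_left (T.normX_rankOne_le ψ) h0)
  · refine div_le_of_le_mul₀ (T.normX_nonneg γ) h0' (T.le_mul_normX γ h0' ?_)
    intro a ha b hb e
    have h1 : ∀ {a : H →L[ℂ] H} (ha : a ∈ T.XPlus),
        |(ω : T.X →ₗ[ℝ] ℝ) ⟨a, T.mem_X_of_mem_XPlus ha⟩| ≤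
          T.normForm (T.dualToForm ω : T.SesqForm) * (T.oneAdd.traceMul a).toReal := fun ha =>
      abs_le_mul_of_hasSum (hasSum_dualToForm ω ha) (T.hasSum_normSqT ha)
        (fun i => (Complex.abs_re_le_norm _).trans (norm_apply_le_normForm _ _))
    rw [apply_X _ γ ha hb e, mul_add]
    exact (abs_sub _ _).trans (add_le_add (h1 ha) (h1 hb))

theorem re_opTrace_sub {a b : H →L[ℂ] H} (ha : a ∈ T.XPlus) (hb : b ∈ T.XPlus) :
    (opTrace (a - b)).re = (opTrace a).re - (opTrace b).re := by
  have h := (T.traceFunctional 1).map_sub ⟨a, T.mem_X_of_mem_XPlus ha⟩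
    ⟨b, T.mem_X_of_mem_XPlus hb⟩
  simpa only [traceFunctional_apply, one_mul, Submodule.coe_sub] using h

end

end PosOp

/-! ### The main theorem -/

theorem mainTheorem5 {H : Type*} [NormedAddCommGroup H] [InnerProductSpace ℂ H] [CompleteSpace H]
    [TopologicalSpace.SeparableSpace H] (T : PosOp H) :
    -- the rank-one operators `|ψ⟩⟨ψ|` with `ψ` in the form domain belong to `X`, and there is a
    -- linear bijection `Φ` between `X*` and `F(T)` ...
    ∃ hX : ∀ ψ : T.formDomain, InnerProductSpace.rankOne ℂ (ψ : H) (ψ : H) ∈ T.X,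
    ∃ Φ : T.dualX ≃ₗ[ℝ] T.formSpace,
      -- ... which is an isometry,
      (∀ ω : T.dualX, T.normForm (Φ ω : T.SesqForm) = T.normDual (ω : T.X →ₗ[ℝ] ℝ)) ∧
      -- is given by polarization,
      (∀ (ω : T.dualX) (ψ φ : T.formDomain),
        (Φ ω : T.SesqForm) ψ φ =
          1 / 4 * ∑ k ∈ Finset.range 4, Complex.I ^ k *
            (((ω : T.X →ₗ[ℝ] ℝ) ⟨_, hX (ψ + (-Complex.I) ^ k • φ)⟩ : ℝ) : ℂ)) ∧
      (∀ (ω : T.dualX) (ψ : T.formDomain),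
        (Φ ω : T.SesqForm) ψ ψ = (((ω : T.X →ₗ[ℝ] ℝ) ⟨_, hX ψ⟩ : ℝ) : ℂ)) ∧
      -- and whose inverse is given by form sums: `c v` has relative bound less than one for all
      -- small `c > 0`, and whenever it has, the form sum `C` of `T` and `c v` exists, is unique,
      -- and represents the functional that corresponds to `v`.
      (∀ v : T.formSpace,
        (∃ c₀ > 0, ∀ c : ℝ, 0 < c → c < c₀ →
          ∃ a b : ℝ, a < 1 ∧ T.HasRelBound ((c • v : T.formSpace) : T.SesqForm) a b) ∧
        (∀ c : ℝ, 0 < c → ∀ a b : ℝ, a < 1 →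
          T.HasRelBound ((c • v : T.formSpace) : T.SesqForm) a b →
          ∃ C : H →ₗ.[ℂ] H,
            T.IsFormSum ((c • v : T.formSpace) : T.SesqForm) C ∧
            (∀ C₁ : H →ₗ.[ℂ] H,
              T.IsFormSum ((c • v : T.formSpace) : T.SesqForm) C₁ → C₁ = C) ∧
            IsLowerBound C (-b) ∧
            ∀ (hC : IsSelfAdjoint C) (μ : ℝ) (hμ : IsLowerBound C μ),
              ∀ γp ∈ T.XPlus, ∀ γm ∈ T.XPlus, ∀ γ : T.X, (γ : H →L[ℂ] H) = γp - γm →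
                (PosOp.subLowerBound C hC μ hμ).traceMul γp < ⊤ ∧
                (PosOp.subLowerBound C hC μ hμ).traceMul γm < ⊤ ∧
                ((Φ.symm v : T.dualX) : T.X →ₗ[ℝ] ℝ) γ =
                  c⁻¹ * ((((PosOp.subLowerBound C hC μ hμ).traceMul γp).toReal -
                      ((PosOp.subLowerBound C hC μ hμ).traceMul γm).toReal) -
                    ((T.traceMul γp).toReal - (T.traceMul γm).toReal) +
                    μ * (opTrace (γ : H →L[ℂ] H)).re))) := by
  set Φ : T.dualX ≃ₗ[ℝ] T.formSpace := LinearEquiv.ofBijective T.dualToForm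
    ⟨PosOp.dualToForm_injective, PosOp.dualToForm_surjective⟩ with hΦ
  refine ⟨T.rankOne_mem_X, Φ, PosOp.normForm_dualToForm, fun ω ψ φ => ?_, T.dualToForm_self,
    fun v => ⟨PosOp.exists_hasRelBound v, fun c hc a b ha hab => ?_⟩⟩
  · rw [sesq_polarization]
    refine congrArg _ (Finset.sum_congr rfl (fun k _ => congrArg _ ?_))
    exact T.dualToForm_self ω _
  · obtain ⟨C, hC, hCb⟩ := PosOp.exists_isFormSum _ (c • v).2.1 ha hab
    refine ⟨C, hC, fun C₁ h₁ => h₁.unique hC, hCb, ?_⟩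
    intro hCs μ hμ γp hp γm hm γ e
    have hsub := hC.XPlus_subset hCs μ hμ
    refine ⟨(hsub hp).2, (hsub hm).2, ?_⟩
    have hv : T.dualToForm (Φ.symm v) = v := Φ.apply_symm_apply v
    have key : ∀ {a : H →L[ℂ] H} (ha : a ∈ T.XPlus),
        ((Φ.symm v : T.dualX) : T.X →ₗ[ℝ] ℝ) ⟨a, T.mem_X_of_mem_XPlus ha⟩ =
          c⁻¹ * (((PosOp.subLowerBound C hCs μ hμ).traceMul a).toReal - (T.traceMul a).toReal +
            μ * (opTrace a).re) := by
      intro a ha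
      -- The functional and the trace expression are sums of the same series, so they agree for
      -- every admissible c, C and μ, not only for those used to construct the functional.
      have h1 := PosOp.hasSum_dualToForm (Φ.symm v) ha
      rw [hv] at h1
      exact h1.unique (hC.hasSum hc hCs μ hμ ha)
    rw [PosOp.apply_X _ γ hp hm e, key hp, key hm, e, PosOp.re_opTrace_sub hp hm]
    ring
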